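/- Let $M$ be a smooth oriented $d$-dimensional manifold without boundary (Hausdorff, $\sigma$-compact), with a smooth pseudo-Riemannian metric $g$ of arbitrary signature, Hodge star $*$, and volume form $\mathrm{vol}$, so that $\alpha\wedge *\beta=\langle\alpha,\beta\rangle_g\,\mathrm{vol}$. Let $\Omega^p(M)$ be the space of smooth real $p$-forms, $\mathrm d$ the exterior derivative, and let $\delta:\Omega^{k}(M)\to\Omega^{k-1}(M)$, $\delta=(-1)^{d(k+1)+1}(-1)^{s}*\mathrm d*$, be the Hodge codifferential, where $s$ is the number of negative squares in the signature of $g$. Let $\lambda\in C^\infty(M)$ and $w\in\mathbb R$, and set $$\tilde{\mathrm d}:=e^{-w\lambda}\,\mathrm d\,e^{w\lambda},\qquad \tilde\delta:=e^{-w\lambda}\,\delta\,e^{w\lambda},\qquad \langle\eta,\xi\rangle_{\lambda,w}:=\int_M e^{2w\lambda}\,\eta\wedge *\xi ,$$ the pairing being taken for forms $\eta,\xi$ of equal degree such that at least one of them has compact support (on a closed manifold: for all smooth forms). Then: 1. $\tilde\delta$ is a formal adjoint of $\tilde{\mathrm d}$: for every $p\ge 0$, $\tilde\delta$ maps $\Omega^{p+1}(M)$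 to $\Omega^{p}(M)$, it maps compactly supported forms to compactly supported forms, and $\langle\tilde{\mathrm d}\eta,\xi\rangle_{\lambda,w}=\langle\eta,\tilde\delta\xi\rangle_{\lambda,w}$ for all $\eta\in\Omega^p(M)$, $\xi\in\Omega^{p+1}(M)$ of which at least one has compact support. 2. It is the only one: if $\xi\in\Omega^{p+1}(M)$ and $\zeta\in\Omega^p(M)$ satisfy $\langle\tilde{\mathrm d}\eta,\xi\rangle_{\lambda,w}=\langle\eta,\zeta\rangle_{\lambda,w}$ for all compactly supported $\eta\in\Omega^p(M)$, then $\zeta=\tilde\delta\xi$. 3. $\tilde\delta^{\,2}=0$: $\tilde\delta\tilde\delta\xi=0$ for every $p\ge 0$ and $\xi\in\Omega^{p+2}(M)$. -/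

import Mathlib

open Set Filter Topology MeasureTheory
open scoped Manifold ContDiff

noncomputable section

namespace TwistedHodge

/-! ### Linear algebra on a finite-dimensional real vector space -/

section LinearAlgebra

variable {V : Type*} [AddCommGroup V] [Module ℝ V] [TopologicalSpace V]
  [IsTopologicalAddGroup V] [ContinuousSMul ℝ V] [T2Space V] [FiniteDimensional ℝ V]

/-- A multilinear form on a finite-dimensional space is continuous. -/
theorem continuous_multilinear {k : ℕ} (f : MultilinearMap ℝ (fun _ : Fin k => V) ℝ) :
    Continuous f := by
  let b := Module.finBasis ℝ V
  have hf : (f : (Fin k → V) → ℝ) = fun v =>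
      ∑ r : Fin k → Fin (Module.finrank ℝ V), (∏ i, b.repr (v i) (r i)) • f (fun i => b (r i)) := by
    funext v
    conv_lhs => rw [show v = fun i => ∑ j, b.repr (v i) j • b j from
      funext fun i => (b.sum_repr (v i)).symm]
    rw [f.map_sum]
    exact Finset.sum_congr rfl fun r _ => f.map_smul_univ _ _
  rw [hf]
  refine continuous_finsetSum _ fun r _ => Continuous.mul ?_ continuous_const
  exact continuous_finsetProd _ fun i _ =>
    (LinearMap.continuous_of_finiteDimensional (b.coord (r i))).comp (continuous_apply i)

/-- An alternating form on a finite-dimensional space, regarded as a continuous one. -/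
def toCont {k : ℕ} (f : V [⋀^Fin k]→ₗ[ℝ] ℝ) : V [⋀^Fin k]→L[ℝ] ℝ :=
  { f with cont := continuous_multilinear f.toMultilinearMap }

/-- The wedge product of a `k`-form and an `l`-form, as a form of degree `n = k + l`:
`(α ∧ β)(v₁, …, vₙ) = ∑ sign(σ) α(v_{σ(1)}, …, v_{σ(k)}) β(v_{σ(k+1)}, …, v_{σ(n)})`,
the sum running over the `(k, l)`-shuffles `σ`. -/
def wedge {k l n : ℕ} (h : k + l = n) (α : V [⋀^Fin k]→L[ℝ] ℝ) (β : V [⋀^Fin l]→L[ℝ] ℝ) :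
    V [⋀^Fin n]→L[ℝ] ℝ :=
  toCont (((LinearMap.mul' ℝ ℝ).compAlternatingMap
    (α.toAlternatingMap.domCoprod β.toAlternatingMap)).domDomCongr
      (finSumFinEquiv.trans (finCongr h)))

/-- Insert the vectors `u₁, …, u_k` into the first `k` slots of a form of degree `n = k + l`:
the `l`-form `v ↦ θ(u₁, …, u_k, v₁, …, v_l)`. -/
def insertFirst {k l n : ℕ} (h : k + l = n) (θ : V [⋀^Fin n]→ₗ[ℝ] ℝ) (u : Fin k → V) :
    V [⋀^Fin l]→ₗ[ℝ] ℝ :=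
  { (θ.domDomCongr (finSumFinEquiv.trans (finCongr h)).symm).toMultilinearMap.currySum u with
    map_eq_zero_of_eq' := fun v i j hv hij =>
      (θ.domDomCongr (finSumFinEquiv.trans (finCongr h)).symm).map_eq_zero_of_eq
        (Sum.elim u v) (i := Sum.inr i) (j := Sum.inr j) hv (fun e => hij (Sum.inr.inj e)) }

variable {d : ℕ}

/-- The Gram matrix `g(bᵢ, bⱼ)` of a bilinear form in a basis. -/
def gram (g : V →L[ℝ] V →L[ℝ] ℝ) (b : Module.Basis (Fin d) ℝ V) : Matrix (Fin d) (Fin d) ℝ :=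
  Matrix.of fun i j => g (b i) (b j)

/-- The dual frame `bⁱ = ∑ⱼ gⁱʲ bⱼ`, characterized by `g(bⁱ, bⱼ) = δⁱⱼ`
when `g` is symmetric and nondegenerate. -/
def dualFrame (g : V →L[ℝ] V →L[ℝ] ℝ) (b : Module.Basis (Fin d) ℝ V) (i : Fin d) : V :=
  ∑ j, (gram g b)⁻¹ i j • b j

/-- The sign of a `d`-tuple of vectors with respect to an orientation: `1` for a positively
oriented basis, `-1` for a negatively oriented basis, `0` for a linearly dependent tuple. -/
def orientSign (o : Orientation ℝ V (Fin d)) (v : Fin d → V) : ℝ :=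
  (SignType.sign (o.someVector v) : ℝ)

/-- The volume form `√|det g(bᵢ, bⱼ)| b¹ ∧ ⋯ ∧ b^d` (`b` positively oriented), corrected by a
sign for a negatively oriented `b`; it does not depend on the basis `b`. -/
def volForm (g : V →L[ℝ] V →L[ℝ] ℝ) (o : Orientation ℝ V (Fin d))
    (b : Module.Basis (Fin d) ℝ V) : V [⋀^Fin d]→ₗ[ℝ] ℝ :=
  (orientSign o b * Real.sqrt |(gram g b).det|) • b.det

/-- The Hodge star from `k`-forms to `l`-forms, `k + l = d`:
`(*β)(v₁, …, v_l) = (1/k!) ∑ β(b^{i₁}, …, b^{i_k}) vol(b_{i₁}, …, b_{i_k}, v₁, …, v_l)`,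
summed over all `i₁, …, i_k`. It does not depend on the basis `b`, and it is the operator with
`α ∧ *β = ⟨α, β⟩ vol`. -/
def star {k l : ℕ} (h : k + l = d) (g : V →L[ℝ] V →L[ℝ] ℝ) (o : Orientation ℝ V (Fin d))
    (b : Module.Basis (Fin d) ℝ V) (β : V [⋀^Fin k]→L[ℝ] ℝ) : V [⋀^Fin l]→L[ℝ] ℝ :=
  toCont (((k.factorial : ℝ)⁻¹) • ∑ i : Fin k → Fin d,
    β (fun a => dualFrame g b (i a)) • insertFirst h (volForm g o b) (fun a => b (i a)))

end LinearAlgebra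

/-! ### Differential forms on a manifold -/

/-- The model space `ℝ^d`. -/
abbrev E (d : ℕ) : Type := EuclideanSpace ℝ (Fin d)

instance (d : ℕ) (M : Type*) [TopologicalSpace M] [ChartedSpace (E d) M] (x : M) :
    T2Space (TangentSpace (𝓡 d) x) := inferInstanceAs (T2Space (E d))

instance (d : ℕ) (M : Type*) [TopologicalSpace M] [ChartedSpace (E d) M] (x : M) :
    FiniteDimensional ℝ (TangentSpace (𝓡 d) x) := inferInstanceAs (FiniteDimensional ℝ (E d))

/-- The standard basis of `ℝ^d`. -/
def stdBasis (d : ℕ) : Module.Basis (Fin d) ℝ (E d) := (EuclideanSpace.basisFun (Fin d) ℝ).toBasis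

section Forms

variable {d : ℕ} {M : Type*} [TopologicalSpace M] [ChartedSpace (E d) M]

/-- A basis of the tangent space at `x`: as a vector space `T_x M` is the model space `ℝ^d`. -/
def tangentBasis (x : M) : Module.Basis (Fin d) ℝ (TangentSpace (𝓡 d) x) := stdBasis d

variable (d M) in
/-- Differential `k`-forms on `M`, with no regularity imposed. -/
abbrev DForm (k : ℕ) : Type _ := ∀ x : M, (TangentSpace (𝓡 d) x) [⋀^Fin k]→L[ℝ] ℝ

/-- The coordinate expression of a form in the chart at `x₀`: its pullback along the inverse of
the chart (meaningful on the target of the chart). -/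
def chartRep {k : ℕ} (x₀ : M) (θ : DForm d M k) : E d → (E d) [⋀^Fin k]→L[ℝ] ℝ := fun y =>
  (θ ((extChartAt (𝓡 d) x₀).symm y)).compContinuousLinearMap
    (mfderiv 𝓘(ℝ, E d) (𝓡 d) (extChartAt (𝓡 d) x₀).symm y)

/-- A form is smooth if its expressions in charts are smooth. -/
def IsSmooth {k : ℕ} (θ : DForm d M k) : Prop :=
  ∀ x₀ : M, ContDiffOn ℝ ∞ (chartRep x₀ θ) (extChartAt (𝓡 d) x₀).target

/-- A form has compact support. -/
def IsCompactlySupported {k : ℕ} (θ : DForm d M k) : Prop :=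
  IsCompact (closure {x : M | θ x ≠ 0})

/-- The exterior derivative, computed at `x` in the chart at `x`. -/
def extD {k : ℕ} (θ : DForm d M k) : DForm d M (k + 1) := fun x =>
  (extDeriv (chartRep x θ) (extChartAt (𝓡 d) x x)).compContinuousLinearMap
    (mfderiv (𝓡 d) 𝓘(ℝ, E d) (extChartAt (𝓡 d) x) x)

/-- The product of a function and a form. -/
def mulForm {k : ℕ} (f : M → ℝ) (θ : DForm d M k) : DForm d M k := fun x => f x • θ x

/-- The coordinate frame `∂₁, …, ∂_d` of the chart at `x₀`, at the point with coordinates `y`. -/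
def chartFrame (x₀ : M) (y : E d) :
    Fin d → TangentSpace (𝓡 d) ((extChartAt (𝓡 d) x₀).symm y) := fun i =>
  mfderiv 𝓘(ℝ, E d) (𝓡 d) (extChartAt (𝓡 d) x₀).symm y (stdBasis d i)

end Forms

/-- An orientation of `M`: an orientation of every tangent space, such that the sign of each
coordinate frame is locally constant. -/
structure ManifoldOrientation (d : ℕ) (M : Type*) [TopologicalSpace M] [ChartedSpace (E d) M] where
  orient : ∀ x : M, Orientation ℝ (TangentSpace (𝓡 d) x) (Fin d)
  locallyConstant : ∀ x₀ : M, ContinuousOn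
    (fun y : E d => orientSign (orient ((extChartAt (𝓡 d) x₀).symm y)) (chartFrame x₀ y))
    (extChartAt (𝓡 d) x₀).target

/-- A smooth pseudo-Riemannian metric on `M` (of any signature; Riemannian metrics included). -/
structure PseudoRiemannianMetric (d : ℕ) (M : Type*) [TopologicalSpace M] [ChartedSpace (E d) M]
    [IsManifold (𝓡 d) ∞ M] where
  val : ∀ x : M, TangentSpace (𝓡 d) x →L[ℝ] TangentSpace (𝓡 d) x →L[ℝ] ℝ
  symm : ∀ (x : M) (u v : TangentSpace (𝓡 d) x), val x u v = val x v u
  nondegenerate : ∀ (x : M) (u : TangentSpace (𝓡 d) x), (∀ v, val x u v = 0) → u = 0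
  contMDiff : ContMDiff (𝓡 d) ((𝓡 d).prod 𝓘(ℝ, E d →L[ℝ] E d →L[ℝ] ℝ)) ∞
    (fun x : M => Bundle.TotalSpace.mk' (E d →L[ℝ] E d →L[ℝ] ℝ)
      (E := fun x : M => TangentSpace (𝓡 d) x →L[ℝ] TangentSpace (𝓡 d) x →L[ℝ] ℝ) x (val x))

section Hodge

variable {d : ℕ} {M : Type*} [TopologicalSpace M] [ChartedSpace (E d) M]
  [IsManifold (𝓡 d) ∞ M]

/-- The Hodge star of a pseudo-Riemannian metric on an oriented manifold. -/
def hodgeStar (g : PseudoRiemannianMetric d M) (o : ManifoldOrientation d M) {k l : ℕ}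
    (h : k + l = d) (β : DForm d M k) : DForm d M l := fun x =>
  star h (g.val x) (o.orient x) (tangentBasis x) (β x)

/-- The sign `(-1)^s` of the determinant of the metric, where `s` is the number of negative
squares in its signature. -/
def metricSign (g : PseudoRiemannianMetric d M) (x : M) : ℝ :=
  (SignType.sign (gram (g.val x) (tangentBasis x)).det : ℝ)

/-- The Hodge codifferential on forms of degree `k = p + 1`:
`δ = (-1)^(d(k+1)+1) (-1)^s * d *`. Forms of degree `k > d` vanish, and `δ` is zero on them. -/
def codiff (g : PseudoRiemannianMetric d M) (o : ManifoldOrientation d M) {p : ℕ}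
    (ξ : DForm d M (p + 1)) : DForm d M p :=
  if h : p + 1 ≤ d then fun x =>
    ((-1 : ℝ) ^ (d * (p + 2) + 1) * metricSign g x) •
      hodgeStar g o (k := d - (p + 1) + 1) (l := p) (by omega)
        (extD (hodgeStar g o (k := p + 1) (l := d - (p + 1)) (by omega) ξ)) x
  else 0

variable [T2Space M] [SigmaCompactSpace M]

variable (d M) in
/-- A smooth partition of unity subordinate to the domains of the charts. -/
def chartPartition : SmoothPartitionOfUnity M (𝓡 d) M univ :=
  (SmoothPartitionOfUnity.exists_isSubordinate_chartAt_source (𝓡 d) M).choose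

/-- The integral of a compactly supported `d`-form over the oriented manifold `M`: the sum over
the charts of the integrals of the pieces cut out by a partition of unity, each computed in
coordinates (with a sign where the chart reverses the orientation). -/
def integralForm (o : ManifoldOrientation d M) (θ : DForm d M d) : ℝ :=
  ∑ᶠ i : M, ∫ y in (extChartAt (𝓡 d) i).target,
    chartPartition d M i ((extChartAt (𝓡 d) i).symm y) *
      (orientSign (o.orient ((extChartAt (𝓡 d) i).symm y)) (chartFrame i y) *
        chartRep i θ y (stdBasis d))

/-- The weighted pairing `⟨η, ξ⟩ = ∫_M e^{2wλ} η ∧ *ξ` of forms of degree `k`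
(forms of degree `k > d` vanish, and their pairing is zero). -/
def weightedPairing (g : PseudoRiemannianMetric d M) (o : ManifoldOrientation d M)
    (lam : M → ℝ) (w : ℝ) {k : ℕ} (η ξ : DForm d M k) : ℝ :=
  if h : k ≤ d then
    integralForm o (mulForm (fun x => Real.exp (2 * w * lam x)) fun x =>
      wedge (k := k) (l := d - k) (by omega) (η x) (hodgeStar g o (by omega) ξ x))
  else 0

end Hodge

section Twisted

variable {d : ℕ} {M : Type*} [TopologicalSpace M] [ChartedSpace (E d) M]

/-- The twisted exterior derivative `e^{-wλ} d e^{wλ}`. -/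
def twistedD (lam : M → ℝ) (w : ℝ) {p : ℕ} (η : DForm d M p) : DForm d M (p + 1) :=
  mulForm (fun x => Real.exp (-(w * lam x))) (extD (mulForm (fun x => Real.exp (w * lam x)) η))

/-- The twisted codifferential `e^{-wλ} δ e^{wλ}`. -/
def twistedCodiff [IsManifold (𝓡 d) ∞ M] (g : PseudoRiemannianMetric d M)
    (o : ManifoldOrientation d M) (lam : M → ℝ) (w : ℝ) {p : ℕ} (ξ : DForm d M (p + 1)) :
    DForm d M p :=
  mulForm (fun x => Real.exp (-(w * lam x)))
    (codiff g o (mulForm (fun x => Real.exp (w * lam x)) ξ))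

/-- `T` is a formal adjoint of `D : Ω^p(M) → Ω^{p+1}(M)` for the given pairings of forms: it maps
smooth forms to smooth forms, preserves compact supports, and `⟨D η, ξ⟩ = ⟨η, T ξ⟩` for smooth
forms of which at least one has compact support (on a closed manifold: for all smooth forms). -/
def IsFormalAdjoint (pairing : ∀ {k : ℕ}, DForm d M k → DForm d M k → ℝ) {p : ℕ}
    (D : DForm d M p → DForm d M (p + 1)) (T : DForm d M (p + 1) → DForm d M p) : Prop :=
  (∀ ξ, IsSmooth ξ → IsSmooth (T ξ)) ∧
  (∀ ξ, IsSmooth ξ → IsCompactlySupported ξ → IsCompactlySupported (T ξ)) ∧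
  ∀ η ξ, IsSmooth η → IsSmooth ξ → (IsCompactlySupported η ∨ IsCompactlySupported ξ) →
    pairing (D η) ξ = pairing η (T ξ)

end Twisted

end TwistedHodge

end

/-!
The exponentials enter only through the substitution `η' = e^{wλ} η`, `ξ' = e^{wλ} ξ`: the weight
`e^{2wλ}` of the pairing absorbs the factor `e^{-wλ}` of either twisted operator, so that
`⟨d̃ η, ξ⟩ = ∫ dη' ∧ *ξ'` and `⟨η, δ̃ ξ⟩ = ∫ η' ∧ *δξ'`
(`weightedPairing_mulForm_left`, `weightedPairing_mulForm_right`). The rest concerns the untwisted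
`d` and `δ`.

*Adjointness.* On forms of degree `l = d - k` one has `** = (-1)^(kl) (-1)^s` (`star_star`), whence
`η' ∧ *δξ' = (-1)^(p+1) η' ∧ d*ξ'` (`wedge_hodgeStar_codiff`). The claim becomes Stokes' theorem in
the form `∫ (dη ∧ ν + (-1)^p η ∧ dν) = 0`, for smooth `η`, `ν` whose supports have compact
intersection (`integralForm_leibnizForm`). There a partition of unity splits `η` into pieces
supported in chart domains. In a chart the integrand is a sum of partial derivatives of compactly
supported functions (`leibniz_stdBasis`, `integral_fderiv_of_compact`), because the components of a
wedge product are contractions with the Levi-Civita symbol (`wedge_basis`). That the integral,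
defined by a fixed partition of unity, may be computed in any chart containing the support is the
change of variables formula (`integralForm_eq_setIntegral`).

*Uniqueness.* By adjointness it suffices that the pairing separates smooth forms. Testing against
`u • α` in a chart, with `u` a bump function and `α` a constant form, gives
`α ∧ μ = 0` for all `α` at every point (`eq_zero_of_integralForm_wedge`); the wedge pairing is
nondegenerate (`eq_zero_of_wedge_eq_zero`) and the Hodge star is injective (`hodgeStar_injective`).

*Square zero.* The factors `e^{wλ}` and `e^{-wλ}` in the middle of `δ̃ δ̃` cancel, and `δδ = 0`
since `**` is multiplication by a locally constant sign and `dd = 0` (`codiff_codiff`).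

All of this requires the Hodge star to preserve smoothness (`IsSmooth.hodgeStar`), which is read off
from its expression in a coordinate frame; the frame may be chosen freely because the Hodge star
does not depend on the basis used to define it (`star_eq`).
-/

noncomputable section

namespace TwistedHodge

/-! ### Concatenation of tuples -/

section Concatenation

variable {X Y : Type*}

/-- The concatenation of a `k`-tuple and an `l`-tuple, as a tuple of length `n = k + l`. -/
def cat {k l n : ℕ} (h : k + l = n) (u : Fin k → X) (v : Fin l → X) : Fin n → X := fun m =>
  Sum.elim u v ((finSumFinEquiv.trans (finCongr h)).symm m)

theorem comp_cat (f : X → Y) {k l n : ℕ} (h : k + l = n) (u : Fin k → X) (v : Fin l → X) :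
    (fun m => f (cat h u v m)) = cat h (fun a => f (u a)) (fun a => f (v a)) := by
  funext m
  simp only [cat]
  cases (finSumFinEquiv.trans (finCongr h)).symm m <;> rfl

/-- Tuples of length `n = k + l` are pairs of a `k`-tuple and an `l`-tuple. -/
def catEquiv (X : Type*) {k l n : ℕ} (h : k + l = n) :
    (Fin k → X) × (Fin l → X) ≃ (Fin n → X) :=
  (Equiv.sumArrowEquivProdArrow _ _ X).symm.trans
    (Equiv.arrowCongr (finSumFinEquiv.trans (finCongr h)) (Equiv.refl X))

theorem catEquiv_apply {k l n : ℕ} (h : k + l = n) (u : Fin k → X) (v : Fin l → X) :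
    catEquiv X h (u, v) = cat h u v := rfl

theorem cat_inl {k l n : ℕ} (h : k + l = n) (u : Fin k → X) (v : Fin l → X) (a : Fin k) :
    cat h u v (finSumFinEquiv.trans (finCongr h) (Sum.inl a)) = u a := by
  simp only [cat, Equiv.symm_apply_apply, Sum.elim_inl]

theorem cat_inr {k l n : ℕ} (h : k + l = n) (u : Fin k → X) (v : Fin l → X) (a : Fin l) :
    cat h u v (finSumFinEquiv.trans (finCongr h) (Sum.inr a)) = v a := by
  simp only [cat, Equiv.symm_apply_apply, Sum.elim_inr]

theorem cat_left {k l n : ℕ} (h : k + l = n) (u : Fin k → X) (v : Fin l → X) (a : Fin k)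
    (ha : (a : ℕ) < n) : cat h u v ⟨a, ha⟩ = u a := cat_inl h u v a

theorem cat_right {k l n : ℕ} (h : k + l = n) (u : Fin k → X) (v : Fin l → X) (a : Fin l)
    (ha : k + (a : ℕ) < n) : cat h u v ⟨k + a, ha⟩ = v a := cat_inr h u v a

/-- A tuple is the concatenation of `u` and `v` as soon as its first entries are those of `u` and
its last entries those of `v`. -/
theorem eq_cat {k l n : ℕ} (h : k + l = n) (u : Fin k → X) (v : Fin l → X) (w : Fin n → X)
    (hu : ∀ (a : Fin k) (ha : (a : ℕ) < n), w ⟨a, ha⟩ = u a)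
    (hv : ∀ (a : Fin l) (ha : k + (a : ℕ) < n), w ⟨k + a, ha⟩ = v a) : w = cat h u v := by
  funext ⟨m, hm⟩
  by_cases hk : m < k
  · rw [hu ⟨m, hk⟩ hm, cat_left h u v ⟨m, hk⟩ hm]
  · obtain ⟨a, rfl⟩ := Nat.exists_eq_add_of_le (not_lt.mp hk)
    rw [hv ⟨a, by omega⟩ hm, cat_right h u v ⟨a, by omega⟩ hm]

theorem cat_cons {k l n : ℕ} (h : k + 1 + l = n + 1) (h' : k + l = n) (x : X) (u : Fin k → X)
    (v : Fin l → X) : cat h (Fin.cons x u) v = Fin.cons x (cat h' u v) := by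
  refine (eq_cat h _ _ _ (fun a ha => ?_) fun a ha => ?_).symm
  · refine Fin.cases (fun _ => rfl) (fun a ha => ?_) a ha
    exact cat_left h' u v a (by simpa using ha)
  · have : (⟨k + 1 + a, ha⟩ : Fin (n + 1)) = Fin.succ ⟨k + a, by omega⟩ :=
      Fin.ext (by simp; omega)
    rw [this, Fin.cons_succ]
    exact cat_right h' u v a (by omega)

theorem cat_nil {l n : ℕ} (h : 0 + l = n) (h' : l + 0 = n) (u : Fin 0 → X) (v : Fin l → X) :
    cat h u v = cat h' v u := by
  refine eq_cat h' v u _ (fun a ha => ?_) fun a => a.elim0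
  have := cat_right h u v a (by omega)
  simpa using this

theorem cat_cons_right {k l n : ℕ} (h : k + (l + 1) = n + 1) (h' : k + l = n) (x : X)
    (u : Fin k → X) (v : Fin l → X) :
    cat h u (Fin.cons x v) = Fin.insertNth (⟨k, by omega⟩ : Fin (n + 1)) x (cat h' u v) := by
  rw [Fin.eq_insertNth_iff]
  refine ⟨cat_right h u (Fin.cons x v) (0 : Fin (l + 1)) (by simp; omega),
    eq_cat h' u v _ (fun a ha => ?_) fun a ha => ?_⟩
  · rw [← cat_left h u (Fin.cons x v) a (by omega)]
    simp only [Fin.removeNth]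
    congr 1
    ext
    simp [Fin.succAbove, Fin.lt_def]
  · have := cat_right h u (Fin.cons x v) a.succ (by simp; omega)
    rw [Fin.cons_succ] at this
    rw [← this]
    simp only [Fin.removeNth]
    congr 1
    ext
    simp [Fin.succAbove, Fin.lt_def]
    omega

end Concatenation

section Alternating

variable {V : Type*} [AddCommGroup V] [Module ℝ V]

theorem insertFirst_apply {k l n : ℕ} (h : k + l = n) (θ : V [⋀^Fin n]→ₗ[ℝ] ℝ)
    (u : Fin k → V) (v : Fin l → V) : insertFirst h θ u v = θ (cat h u v) := rfl

/-- Moving a block of `k` vectors past a block of `l` vectors costs the sign `(-1)^(kl)`. -/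
theorem map_cat_swap {k l n : ℕ} (h : k + l = n) (h' : l + k = n) (θ : V [⋀^Fin n]→ₗ[ℝ] ℝ)
    (u : Fin k → V) (v : Fin l → V) :
    θ (cat h u v) = (-1) ^ (k * l) * θ (cat h' v u) := by
  induction k generalizing n with
  | zero => simp [cat_nil h h']
  | succ k ih =>
    obtain ⟨n, rfl⟩ : ∃ m, n = m + 1 := ⟨n - 1, by omega⟩
    have hk : k + l = n := by omega
    have hk' : l + k = n := by omega
    have h1 : θ (Fin.cons (u 0) (cat hk (Fin.tail u) v)) =
      (-1) ^ (k * l) * θ (Matrix.vecCons (u 0) (cat hk' v (Fin.tail u))) :=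
      ih hk hk' (θ.curryLeft (u 0)) (Fin.tail u)
    rw [← Fin.cons_self_tail u, cat_cons h hk, cat_cons_right h' hk', AlternatingMap.map_insertNth,
      h1]
    have h2 : ((-1 : ℝ) ^ l) * (-1) ^ l = 1 := by rw [← mul_pow]; simp
    simp only [zsmul_eq_mul]
    push_cast
    rw [add_mul, one_mul, pow_add]
    linear_combination (-(-1) ^ (k * l) * θ (Matrix.vecCons (u 0) (cat hk' v (Fin.tail u)))) * h2

end Alternating

/-! ### Levi-Civita symbols -/

section PermSign

variable {V : Type*} [AddCommGroup V] [Module ℝ V] {d : ℕ}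

/-- The sign of a map `f : Fin d → Fin d`: the sign of `f` if it is a permutation, `0` otherwise. -/
def permSign (f : Fin d → Fin d) : ℝ :=
  (Pi.basisFun ℝ (Fin d)).det fun m => Pi.basisFun ℝ (Fin d) (f m)

theorem det_basis_comp (b : Module.Basis (Fin d) ℝ V) (f : Fin d → Fin d) :
    b.det (fun m => b (f m)) = permSign f := by
  simp only [permSign, Module.Basis.det_apply]
  congr 1
  ext m n
  simp [Module.Basis.toMatrix_apply, Pi.single_apply, Finsupp.single_apply, eq_comm]

theorem permSign_perm (σ : Equiv.Perm (Fin d)) : permSign σ = (Equiv.Perm.sign σ : ℤ) := by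
  have := (Pi.basisFun ℝ (Fin d)).det.map_perm (Pi.basisFun ℝ (Fin d)) σ
  rw [Module.Basis.det_self] at this
  simpa [permSign, Units.smul_def, Function.comp_def] using this

theorem permSign_eq_zero {f : Fin d → Fin d} (hf : ¬ Function.Injective f) : permSign f = 0 := by
  refine AlternatingMap.map_eq_zero_of_not_injective _ _ fun h => hf fun a b hab => h ?_
  simp [hab]

theorem permSign_sq_of_injective {f : Fin d → Fin d} (hf : Function.Injective f) :
    permSign f * permSign f = 1 := by
  have h := permSign_perm (Equiv.ofBijective f (Finite.injective_iff_bijective.mp hf))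
  rw [Equiv.coe_ofBijective] at h
  rw [h]
  exact_mod_cast Int.units_coe_mul_self _

theorem sum_permSign_mul (F : (Fin d → Fin d) → ℝ) :
    ∑ f, permSign f * F f = ∑ σ : Equiv.Perm (Fin d), ((Equiv.Perm.sign σ : ℤ) : ℝ) * F σ := by
  symm
  refine Finset.sum_bij_ne_zero (fun σ _ _ => (σ : Fin d → Fin d)) (fun _ _ _ => Finset.mem_univ _)
    (fun σ _ _ τ _ _ h => DFunLike.coe_injective h) (fun f _ hf => ?_) fun σ _ _ => ?_
  · have hf' : Function.Injective f := by
      by_contra h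
      exact hf (by rw [permSign_eq_zero h, zero_mul])
    refine ⟨Equiv.ofBijective f (Finite.injective_iff_bijective.mp hf'), Finset.mem_univ _, ?_, rfl⟩
    rwa [← permSign_perm]
  · rw [permSign_perm]

theorem permSign_cat_swap {k l : ℕ} (h : k + l = d) (h' : l + k = d) (i : Fin k → Fin d)
    (j : Fin l → Fin d) :
    permSign (cat h i j) = (-1) ^ (k * l) * permSign (cat h' j i) := by
  have := map_cat_swap h h' (Pi.basisFun ℝ (Fin d)).det (fun a => Pi.basisFun ℝ (Fin d) (i a))
    (fun a => Pi.basisFun ℝ (Fin d) (j a))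
  simpa only [permSign, ← comp_cat (Pi.basisFun ℝ (Fin d))] using this

theorem permSign_mul_perm {k l : ℕ} (h : k + l = d) (i : Fin k → Fin d) (j : Fin l → Fin d)
    (π : Equiv.Perm (Fin l)) :
    permSign (cat h i (j ∘ π)) = (Equiv.Perm.sign π : ℤ) * permSign (cat h i j) := by
  have := (insertFirst h (V := Fin d → ℝ) (Pi.basisFun ℝ (Fin d)).det
    (fun a => Pi.basisFun ℝ (Fin d) (i a))).map_perm (fun a => Pi.basisFun ℝ (Fin d) (j a)) π
  simp only [insertFirst_apply] at this
  simp only [permSign, comp_cat (Pi.basisFun ℝ (Fin d))]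
  rw [← zsmul_eq_mul, ← Units.smul_def, ← this]
  rfl

theorem cat_injective_iff {X : Type*} {k l n : ℕ} (h : k + l = n) (i : Fin k → X)
    (j : Fin l → X) :
    Function.Injective (cat h i j) ↔
      Function.Injective i ∧ Function.Injective j ∧ ∀ a b, i a ≠ j b := by
  rw [← Sum.elim_injective]
  exact (Equiv.injective_comp (finSumFinEquiv.trans (finCongr h)).symm (Sum.elim i j))

/-- Only the rearrangements of a complement `j'` of `i` contribute to `∑ ε_{i j} F_j`, and all
of them contribute equally if `F` is antisymmetric. -/
theorem sum_permSign_cat_right {k l : ℕ} (h : k + l = d) (i : Fin k → Fin d) (j' : Fin l → Fin d)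
    (hij : Function.Injective (cat h i j')) (F : (Fin l → Fin d) → ℝ)
    (hF : ∀ π : Equiv.Perm (Fin l), F (j' ∘ π) = (Equiv.Perm.sign π : ℤ) * F j') :
    ∑ j, permSign (cat h i j) * F j = l.factorial * (permSign (cat h i j') * F j') := by
  obtain ⟨hi, hj', hne⟩ := (cat_injective_iff h i j').mp hij
  have hsurj : ∀ x, (∀ a, i a ≠ x) → ∃ b, j' b = x := by
    intro x hx
    obtain ⟨m, hm⟩ := (Finite.injective_iff_surjective.mp hij) x
    simp only [cat] at hm
    rcases hs : (finSumFinEquiv.trans (finCongr h)).symm m with a | b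
    · rw [hs] at hm
      exact absurd hm (hx a)
    · rw [hs] at hm
      exact ⟨b, hm⟩
  have : ∑ j, permSign (cat h i j) * F j =
      ∑ π : Equiv.Perm (Fin l), permSign (cat h i (j' ∘ π)) * F (j' ∘ π) := by
    symm
    refine Finset.sum_bij_ne_zero (fun π _ _ => j' ∘ π) (fun _ _ _ => Finset.mem_univ _)
      (fun σ _ _ τ _ _ hστ => Equiv.ext fun a => hj' (congrFun hστ a)) (fun j _ hj => ?_)
      fun _ _ _ => rfl
    have hinj : Function.Injective (cat h i j) := by
      by_contra hc
      exact hj (by rw [permSign_eq_zero hc, zero_mul])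
    obtain ⟨-, hj1, hj2⟩ := (cat_injective_iff h i j).mp hinj
    choose π hπ using fun a => hsurj (j a) fun c => hj2 c a
    have hπi : Function.Injective π := fun a b hab => hj1 (by rw [← hπ, ← hπ, hab])
    refine ⟨Equiv.ofBijective π (Finite.injective_iff_bijective.mp hπi), Finset.mem_univ _, ?_,
      funext hπ⟩
    have : j' ∘ (Equiv.ofBijective π (Finite.injective_iff_bijective.mp hπi)) = j := funext hπ
    rwa [this]
  rw [this]
  have h2 : ∀ π : Equiv.Perm (Fin l), permSign (cat h i (j' ∘ π)) * F (j' ∘ π) =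
      permSign (cat h i j') * F j' := by
    intro π
    rw [permSign_mul_perm, hF]
    have : (((Equiv.Perm.sign π : ℤ) : ℝ)) * ((Equiv.Perm.sign π : ℤ) : ℝ) = 1 := by
      exact_mod_cast Int.units_coe_mul_self _
    linear_combination (permSign (cat h i j') * F j') * this
  simp [h2, Fintype.card_perm]

theorem exists_cat_injective {k l : ℕ} (h : k + l = d) (j : Fin l → Fin d)
    (hj : Function.Injective j) : ∃ i : Fin k → Fin d, Function.Injective (cat h i j) := by
  have hc : Fintype.card ((Set.range j)ᶜ : Set (Fin d)) = k := by
    rw [Fintype.card_compl_set, Set.card_range_of_injective hj]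
    simp
    omega
  let e := (Fintype.equivFinOfCardEq hc).symm
  refine ⟨fun a => e a, (cat_injective_iff h _ j).mpr
    ⟨fun a b hab => e.injective (Subtype.ext hab), hj, fun a b hab => (e a).2 ⟨b, hab.symm⟩⟩⟩

/-- The contraction `∑ ε_{i j} ε_{i j'} F_j = k! l! F_{j'}` of two Levi-Civita symbols against an
antisymmetric array `F`. -/
theorem sum_permSign_permSign {k l : ℕ} (h : k + l = d) (j' : Fin l → Fin d)
    (F : (Fin l → Fin d) → ℝ) (hF0 : ∀ j, ¬ Function.Injective j → F j = 0)
    (hF : ∀ (j : Fin l → Fin d) (π : Equiv.Perm (Fin l)),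
      F (j ∘ π) = (Equiv.Perm.sign π : ℤ) * F j) :
    ∑ i, ∑ j, permSign (cat h i j) * permSign (cat h i j') * F j =
      k.factorial * l.factorial * F j' := by
  by_cases hj' : Function.Injective j'
  · have h' : l + k = d := by omega
    have h1 : ∀ i : Fin k → Fin d, ∑ j, permSign (cat h i j) * permSign (cat h i j') * F j =
        l.factorial * F j' * (permSign (cat h' j' i) * permSign (cat h' j' i)) := by
      intro i
      have hsq : permSign (cat h' j' i) * permSign (cat h' j' i) =
          permSign (cat h i j') * permSign (cat h i j') := by
        rw [permSign_cat_swap h h' i j', mul_mul_mul_comm, ← pow_add, ← two_mul,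
          pow_mul, neg_one_sq, one_pow, one_mul]
      by_cases hi : Function.Injective (cat h i j')
      · have := sum_permSign_cat_right h i j' hi F (hF j')
        rw [hsq, permSign_sq_of_injective hi, mul_one]
        have hs := permSign_sq_of_injective hi
        calc _ = permSign (cat h i j') * ∑ j, permSign (cat h i j) * F j := by
              rw [Finset.mul_sum]; exact Finset.sum_congr rfl fun j _ => by ring
          _ = _ := by rw [this]; linear_combination (l.factorial * F j') * hs
      · rw [hsq, permSign_eq_zero hi]
        simp
    simp_rw [h1]
    obtain ⟨i, hi⟩ := exists_cat_injective h j' hj'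
    have hi' : Function.Injective (cat h' j' i) := by
      rw [cat_injective_iff] at hi ⊢
      exact ⟨hi.2.1, hi.1, fun a b hab => hi.2.2 b a hab.symm⟩
    rw [← Finset.mul_sum, sum_permSign_cat_right h' j' i hi' (fun i => permSign (cat h' j' i))
      (fun π => permSign_mul_perm h' j' i π), permSign_sq_of_injective hi']
    ring
  · have : ∀ i : Fin k → Fin d, permSign (cat h i j') = 0 := fun i =>
      permSign_eq_zero fun hc => hj' ((cat_injective_iff h i j').mp hc).2.1
    simp [this, hF0 j' hj']

end PermSign

/-! ### Contractions of multilinear forms -/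

section Contraction

variable {V : Type*} [AddCommGroup V] [Module ℝ V] {d k l : ℕ}

theorem map_sum_matrix_smul (f : MultilinearMap ℝ (fun _ : Fin k => V) ℝ)
    (A : Matrix (Fin d) (Fin d) ℝ) (x : Fin d → V) (i : Fin k → Fin d) :
    f (fun a => ∑ j, A (i a) j • x j) = ∑ r : Fin k → Fin d, (∏ a, A (i a) (r a)) * f (x ∘ r) := by
  rw [f.map_sum]
  exact Finset.sum_congr rfl fun r _ => f.map_smul_univ _ _

/-- Full contraction of two multilinear forms against a pair of dual families does not depend on
the pair: `∑ f(x_{i₁}, …) g(y_{i₁}, …)` is unchanged when `x`, `y` are replaced by `A x`, `B y` with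
`Aᵀ B = 1`. -/
theorem sum_contract (f g : MultilinearMap ℝ (fun _ : Fin k => V) ℝ)
    (A B : Matrix (Fin d) (Fin d) ℝ) (hAB : A.transpose * B = 1) (x y : Fin d → V) :
    ∑ i : Fin k → Fin d, f (fun a => ∑ j, A (i a) j • x j) * g (fun a => ∑ j, B (i a) j • y j) =
      ∑ i : Fin k → Fin d, f (x ∘ i) * g (y ∘ i) := by
  have key : ∀ r s : Fin k → Fin d,
      ∑ i : Fin k → Fin d, (∏ a, A (i a) (r a)) * (∏ a, B (i a) (s a)) =
        if r = s then 1 else 0 := by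
    intro r s
    simp_rw [← Finset.prod_mul_distrib]
    have := (Finset.prod_univ_sum (fun _ : Fin k => (Finset.univ : Finset (Fin d)))
      (fun a t => A t (r a) * B t (s a)))
    rw [Fintype.piFinset_univ] at this
    rw [← this]
    have h2 : ∀ a, ∑ t, A t (r a) * B t (s a) = if r a = s a then 1 else 0 := by
      intro a
      have := congrFun (congrFun hAB (r a)) (s a)
      simpa [Matrix.mul_apply, Matrix.one_apply] using this
    simp_rw [h2]
    rw [Finset.prod_ite_zero]
    simp [funext_iff]
  simp_rw [map_sum_matrix_smul, Finset.sum_mul_sum]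
  calc _ = ∑ r : Fin k → Fin d, ∑ s : Fin k → Fin d, (∑ i : Fin k → Fin d,
        (∏ a, A (i a) (r a)) * (∏ a, B (i a) (s a))) * (f (x ∘ r) * g (y ∘ s)) := by
        rw [Finset.sum_comm]
        refine Finset.sum_congr rfl fun r _ => ?_
        rw [Finset.sum_comm]
        refine Finset.sum_congr rfl fun s _ => ?_
        rw [Finset.sum_mul]
        exact Finset.sum_congr rfl fun i _ => by ring
    _ = _ := by simp [key]

end Contraction

/-! ### Orientations, Gram matrices and the volume form -/

section VolumeForm

variable {V : Type*} [AddCommGroup V] [Module ℝ V] {d k : ℕ}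

theorem alternatingMap_sum_apply {ι : Type*} (s : Finset ι) (f : ι → V [⋀^Fin k]→ₗ[ℝ] ℝ)
    (v : Fin k → V) : (∑ i ∈ s, f i) v = ∑ i ∈ s, f i v :=
  map_sum (⟨⟨fun θ => θ v, rfl⟩, fun _ _ => rfl⟩ : (V [⋀^Fin k]→ₗ[ℝ] ℝ) →+ ℝ) f s

/-- The sign of a tuple with respect to an orientation changes by the sign of the determinant. -/
theorem orientSign_eq (o : Orientation ℝ V (Fin d)) (b : Module.Basis (Fin d) ℝ V)
    (v : Fin d → V) : orientSign o v = (SignType.sign (b.det v) : ℝ) * orientSign o b := by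
  have h : o.someVector v = o.someVector b * b.det v :=
    congrArg (fun θ => θ v) (AlternatingMap.eq_smul_basis_det b o.someVector)
  rw [orientSign, orientSign, h, sign_mul, mul_comm, SignType.coe_mul]

/-- A basis has orientation sign `1` or `-1`. -/
theorem orientSign_sq (o : Orientation ℝ V (Fin d)) (b : Module.Basis (Fin d) ℝ V) :
    orientSign o b * orientSign o b = 1 := by
  have h : o.someVector b ≠ 0 := fun h => o.someVector_ne_zero
    ((AlternatingMap.map_basis_eq_zero_iff b _).mp h)
  rw [orientSign]
  rcases h.lt_or_gt with h | h
  · simp [sign_neg h]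
  · simp [sign_pos h]

variable [TopologicalSpace V]

theorem toMultilinear_apply (β : V [⋀^Fin k]→L[ℝ] ℝ) (v : Fin k → V) :
    β.toAlternatingMap.toMultilinearMap v = β v := rfl

theorem apply_eq_sum_repr (b : Module.Basis (Fin d) ℝ V) (γ : V [⋀^Fin k]→L[ℝ] ℝ)
    (v : Fin k → V) :
    γ v = ∑ r : Fin k → Fin d, (∏ i, b.repr (v i) (r i)) • γ (fun i => b (r i)) := by
  conv_lhs => rw [show v = fun i => ∑ j, b.repr (v i) j • b j from
    funext fun i => (b.sum_repr (v i)).symm]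
  rw [← toMultilinear_apply, MultilinearMap.map_sum]
  exact Finset.sum_congr rfl fun r _ => MultilinearMap.map_smul_univ _ _ _

theorem ext_basis (b : Module.Basis (Fin d) ℝ V) {α β : V [⋀^Fin k]→L[ℝ] ℝ}
    (h : ∀ j : Fin k → Fin d, α (fun a => b (j a)) = β (fun a => b (j a))) : α = β := by
  ext v
  rw [apply_eq_sum_repr b α, apply_eq_sum_repr b β]
  simp [h]

theorem volForm_basis_comp (g : V →L[ℝ] V →L[ℝ] ℝ) (o : Orientation ℝ V (Fin d))
    (b : Module.Basis (Fin d) ℝ V) (f : Fin d → Fin d) :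
    volForm g o b (fun m => b (f m)) =
      orientSign o b * Real.sqrt |(gram g b).det| * permSign f := by
  simp [volForm, det_basis_comp]

variable (g : V →L[ℝ] V →L[ℝ] ℝ)

theorem gram_transpose (hs : ∀ u v, g u v = g v u) (b : Module.Basis (Fin d) ℝ V) :
    (gram g b).transpose = gram g b := by
  ext i j
  exact hs _ _

theorem gram_det_ne_zero (hn : ∀ u, (∀ v, g u v = 0) → u = 0) (b : Module.Basis (Fin d) ℝ V) :
    (gram g b).det ≠ 0 := by
  intro h
  obtain ⟨c, hc, hc0⟩ := Matrix.exists_vecMul_eq_zero_iff.mpr h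
  apply hc
  have h0 : ∑ i, c i • b i = 0 := by
    refine hn _ fun v => ?_
    have : ∀ j, g (∑ i, c i • b i) (b j) = 0 := by
      intro j
      have := congrFun hc0 j
      simpa [Matrix.vecMul, dotProduct, gram] using this
    have h3 : (g (∑ i, c i • b i)).toLinearMap = 0 := b.ext fun j => by simpa using this j
    exact congrArg (fun f : V →ₗ[ℝ] ℝ => f v) h3
  funext i
  have := congrArg (fun v => b.repr v i) h0
  simpa [Finsupp.single_apply] using this

theorem gram_changeBasis (b b' : Module.Basis (Fin d) ℝ V) :
    gram g b' = (b.toMatrix b').transpose * gram g b * b.toMatrix b' := by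
  ext i j
  have h : ∀ i, b' i = ∑ m, b.toMatrix b' m i • b m := fun i => (b.sum_toMatrix_smul_self b' i).symm
  have : g (b' i) (b' j) = ∑ m, ∑ n, b.toMatrix b' m i * (b.toMatrix b' n j * g (b m) (b n)) := by
    conv_lhs => rw [h i, h j]
    simp only [map_sum, map_smul, FunLike.coe_sum, FunLike.coe_smul, Finset.sum_apply,
      Pi.smul_apply, smul_eq_mul, Finset.mul_sum]
    rw [Finset.sum_comm]
    exact Finset.sum_congr rfl fun m _ => Finset.sum_congr rfl fun n _ => by ring
  simp only [gram, Matrix.of_apply, Matrix.mul_apply, Matrix.transpose_apply, Finset.sum_mul]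
  rw [this, Finset.sum_comm]
  exact Finset.sum_congr rfl fun m _ => Finset.sum_congr rfl fun n _ => by ring

/-- The volume form does not depend on the basis: the Gram determinant changes by the square of the
determinant of the change of basis, whose sign is made up for by the orientation sign. -/
theorem volForm_eq (o : Orientation ℝ V (Fin d)) (b b' : Module.Basis (Fin d) ℝ V) :
    volForm g o b' = volForm g o b := by
  rw [volForm, volForm, gram_changeBasis g b b', orientSign_eq o b b']
  conv_rhs => rw [AlternatingMap.eq_smul_basis_det b' b.det, smul_smul]
  congr 1
  rw [Matrix.det_mul, Matrix.det_mul, Matrix.det_transpose, ← b.det_apply]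
  have : b.det b' * (gram g b).det * b.det b' = b.det b' ^ 2 * (gram g b).det := by ring
  rw [this, abs_mul, abs_of_nonneg (sq_nonneg (b.det b')), Real.sqrt_mul (sq_nonneg _),
    Real.sqrt_sq_eq_abs]
  have h2 : (SignType.sign (b.det b') : ℝ) * |b.det b'| = b.det b' := sign_mul_abs _
  linear_combination (orientSign o b * √|(gram g b).det|) * h2

theorem sign_gram_det (b b' : Module.Basis (Fin d) ℝ V) :
    SignType.sign (gram g b').det = SignType.sign (gram g b).det := by
  rw [gram_changeBasis g b b', Matrix.det_mul, Matrix.det_mul, Matrix.det_transpose, ← b.det_apply]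
  have h0 : b.det b' ≠ 0 := (b.isUnit_det b').ne_zero
  have : b.det b' * (gram g b).det * b.det b' = b.det b' ^ 2 * (gram g b).det := by ring
  rw [this, sign_mul, sign_pos (by positivity), one_mul]

/-- The dual frame transforms by the inverse of the change of basis matrix. -/
theorem dualFrame_changeBasis (b b' : Module.Basis (Fin d) ℝ V) (i : Fin d) :
    dualFrame g b' i = ∑ j, (b.toMatrix b')⁻¹ i j • dualFrame g b j := by
  have hP : b.toMatrix b' * b'.toMatrix b = 1 := b.toMatrix_mul_toMatrix_flip b'
  have hu : IsUnit (b.toMatrix b').det := Matrix.isUnit_det_of_right_inverse hP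
  have hut : IsUnit (b.toMatrix b').transpose.det := by rwa [Matrix.det_transpose]
  have h : ∀ i, b' i = ∑ m, (b.toMatrix b').transpose i m • b m :=
    fun i => (b.sum_toMatrix_smul_self b' i).symm
  have h1 : ∀ i, dualFrame g b' i =
      ∑ m, ((gram g b')⁻¹ * (b.toMatrix b').transpose) i m • b m := by
    intro i
    simp only [dualFrame, Matrix.mul_apply, Finset.sum_smul]
    rw [Finset.sum_comm]
    refine Finset.sum_congr rfl fun j _ => ?_
    rw [h j, Finset.smul_sum]
    simp [smul_smul]
  have h2 : ∀ i, ∑ j, (b.toMatrix b')⁻¹ i j • dualFrame g b j =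
      ∑ m, ((b.toMatrix b')⁻¹ * (gram g b)⁻¹) i m • b m := by
    intro i
    simp only [dualFrame, Matrix.mul_apply, Finset.sum_smul, Finset.smul_sum, smul_smul]
    rw [Finset.sum_comm]
  rw [h1, h2, gram_changeBasis g b b', Matrix.mul_inv_rev, Matrix.mul_inv_rev,
    Matrix.mul_assoc, Matrix.mul_assoc, Matrix.nonsing_inv_mul _ hut, Matrix.mul_one]

end VolumeForm

/-! ### The wedge product and the Hodge star in components -/

section WedgeStar

variable {V : Type*} [AddCommGroup V] [Module ℝ V] [TopologicalSpace V]
  [IsTopologicalAddGroup V] [ContinuousSMul ℝ V] [T2Space V] [FiniteDimensional ℝ V]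
  {W : Type*} [AddCommGroup W] [Module ℝ W] [TopologicalSpace W]
  [IsTopologicalAddGroup W] [ContinuousSMul ℝ W] [T2Space W] [FiniteDimensional ℝ W]
  {d k l n : ℕ}

theorem toCont_apply (f : V [⋀^Fin k]→ₗ[ℝ] ℝ) (v : Fin k → V) : toCont f v = f v := rfl

/-- The wedge product as a sum over all permutations, each shuffle being counted `k! l!` times. -/
theorem wedge_apply (h : k + l = n) (α : V [⋀^Fin k]→L[ℝ] ℝ) (β : V [⋀^Fin l]→L[ℝ] ℝ)
    (v : Fin n → V) :
    wedge h α β v = ((k.factorial * l.factorial : ℕ) : ℝ)⁻¹ *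
      ∑ σ : Equiv.Perm (Fin n), (Equiv.Perm.sign σ : ℤ) *
        (α (fun a => v (σ (finSumFinEquiv.trans (finCongr h) (Sum.inl a)))) *
          β (fun a => v (σ (finSumFinEquiv.trans (finCongr h) (Sum.inr a))))) := by
  set e := finSumFinEquiv.trans (finCongr h) with he
  have h0 := MultilinearMap.domCoprod_alternization_eq α.toAlternatingMap β.toAlternatingMap
  have h1 := congrArg (fun θ => LinearMap.mul' ℝ ℝ (θ (fun m => v (e m)))) h0
  simp only [Fintype.card_fin, AlternatingMap.smul_apply, map_nsmul] at h1
  have h2 : wedge h α β v = LinearMap.mul' ℝ ℝ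
      ((α.toAlternatingMap.domCoprod β.toAlternatingMap) fun m => v (e m)) := rfl
  rw [h2, eq_inv_mul_iff_mul_eq₀ (by positivity), ← nsmul_eq_mul, ← h1,
    MultilinearMap.alternatization_apply, map_sum, ← e.permCongr.sum_comp]
  refine Finset.sum_congr rfl fun σ _ => ?_
  rw [Units.smul_def, map_zsmul, zsmul_eq_mul]
  simp only [Equiv.permCongr_apply, Equiv.symm_apply_apply, Equiv.Perm.sign_permCongr]
  rfl

theorem wedge_compContinuousLinearMap (h : k + l = n) (α : V [⋀^Fin k]→L[ℝ] ℝ)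
    (β : V [⋀^Fin l]→L[ℝ] ℝ) (A : W →L[ℝ] V) :
    (wedge h α β).compContinuousLinearMap A =
      wedge h (α.compContinuousLinearMap A) (β.compContinuousLinearMap A) := by
  ext v
  rw [ContinuousAlternatingMap.compContinuousLinearMap_apply, wedge_apply, wedge_apply]
  rfl

/-- The wedge product in components: `α ∧ β` on a basis is the contraction of the components of
`α` and `β` with the Levi-Civita symbol. -/
theorem wedge_basis (h : k + l = d) (α : V [⋀^Fin k]→L[ℝ] ℝ) (β : V [⋀^Fin l]→L[ℝ] ℝ)
    (b : Fin d → V) :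
    wedge h α β b = ((k.factorial * l.factorial : ℕ) : ℝ)⁻¹ *
      ∑ i : Fin k → Fin d, ∑ j : Fin l → Fin d,
        permSign (cat h i j) * (α (fun a => b (i a)) * β (fun a => b (j a))) := by
  rw [wedge_apply]
  congr 1
  have := sum_permSign_mul fun f : Fin d → Fin d =>
        (α (fun a => b (f (finSumFinEquiv.trans (finCongr h) (Sum.inl a)))) *
          β (fun a => b (f (finSumFinEquiv.trans (finCongr h) (Sum.inr a)))))
  rw [← this, ← (catEquiv (Fin d) h).sum_comp, Fintype.sum_prod_type]
  refine Finset.sum_congr rfl fun i _ => Finset.sum_congr rfl fun j _ => ?_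
  simp only [catEquiv_apply, cat_inl, cat_inr]

theorem star_apply (h : k + l = d) (g : V →L[ℝ] V →L[ℝ] ℝ) (o : Orientation ℝ V (Fin d))
    (b : Module.Basis (Fin d) ℝ V) (β : V [⋀^Fin k]→L[ℝ] ℝ) (v : Fin l → V) :
    star h g o b β v = (k.factorial : ℝ)⁻¹ * ∑ i : Fin k → Fin d,
      β (fun a => dualFrame g b (i a)) * volForm g o b (cat h (fun a => b (i a)) v) := by
  rw [star, toCont_apply, AlternatingMap.smul_apply, alternatingMap_sum_apply, smul_eq_mul]
  rfl

/-- The Hodge star in components. -/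
theorem star_basis (h : k + l = d) (g : V →L[ℝ] V →L[ℝ] ℝ) (o : Orientation ℝ V (Fin d))
    (b : Module.Basis (Fin d) ℝ V) (β : V [⋀^Fin k]→L[ℝ] ℝ) (j : Fin l → Fin d) :
    star h g o b β (fun a => b (j a)) = (k.factorial : ℝ)⁻¹ *
      ∑ i : Fin k → Fin d, (∑ r : Fin k → Fin d,
        (∏ a, (gram g b)⁻¹ (i a) (r a)) * β (fun a => b (r a))) *
          (orientSign o b * Real.sqrt |(gram g b).det| * permSign (cat h i j)) := by
  rw [star_apply]
  congr 1
  refine Finset.sum_congr rfl fun i _ => ?_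
  rw [← comp_cat b, volForm_basis_comp]
  congr 1
  exact map_sum_matrix_smul β.toAlternatingMap.toMultilinearMap _ b i

variable (g : V →L[ℝ] V →L[ℝ] ℝ)

/-- The Hodge star does not depend on the basis, being the contraction of `β` with the volume form
along a frame and its dual frame. -/
theorem star_eq (h : k + l = d) (o : Orientation ℝ V (Fin d)) (b b' : Module.Basis (Fin d) ℝ V)
    (β : V [⋀^Fin k]→L[ℝ] ℝ) : star h g o b' β = star h g o b β := by
  ext v
  rw [star_apply, star_apply, volForm_eq g o b b']
  congr 1
  have hlk : l + k = d := by omega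
  have hP : b.toMatrix b' * b'.toMatrix b = 1 := b.toMatrix_mul_toMatrix_flip b'
  have hu : IsUnit (b.toMatrix b').det := Matrix.isUnit_det_of_right_inverse hP
  have := sum_contract β.toAlternatingMap.toMultilinearMap
    (insertFirst hlk (volForm g o b) v).toMultilinearMap
    (b.toMatrix b')⁻¹ (b.toMatrix b').transpose
    (by rw [← Matrix.transpose_mul, Matrix.mul_nonsing_inv _ hu, Matrix.transpose_one])
    (dualFrame g b) b
  have h' : ∀ i, b' i = ∑ m, (b.toMatrix b').transpose i m • b m :=
    fun i => (b.sum_toMatrix_smul_self b' i).symm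
  simp only [← dualFrame_changeBasis g b b', ← h'] at this
  have e : ∀ u : Fin k → V, volForm g o b (cat h u v) = (-1) ^ (k * l) *
      (insertFirst hlk (volForm g o b) v).toMultilinearMap u := fun u => map_cat_swap h hlk _ u v
  simp_rw [e, mul_left_comm _ ((-1 : ℝ) ^ (k * l)), ← Finset.mul_sum]
  congr 1

/-- The square of the Hodge star: `** = (-1)^(kl) (-1)^s` on forms of degree `l = d - k`. -/
theorem star_star (hs : ∀ u v, g u v = g v u) (hn : ∀ u, (∀ v, g u v = 0) → u = 0)
    (h₁ : l + k = d) (h₂ : k + l = d) (o : Orientation ℝ V (Fin d)) (b : Module.Basis (Fin d) ℝ V)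
    (μ : V [⋀^Fin l]→L[ℝ] ℝ) :
    star h₂ g o b (star h₁ g o b μ) =
      ((-1) ^ (k * l) * (SignType.sign (gram g b).det : ℝ)) • μ := by
  have hdet := gram_det_ne_zero g hn b
  have hu : IsUnit (gram g b).det := isUnit_iff_ne_zero.mpr hdet
  set c := orientSign o b * Real.sqrt |(gram g b).det| with hc
  -- Lowering the index: the vectors of the frame in terms of the dual frame.
  have hlow : ∀ i, b i = ∑ j, gram g b i j • dualFrame g b j := by
    intro i
    have : ∑ j, gram g b i j • dualFrame g b j = ∑ m, (gram g b * (gram g b)⁻¹) i m • b m := by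
      simp only [dualFrame, Matrix.mul_apply, Finset.sum_smul, Finset.smul_sum, smul_smul]
      rw [Finset.sum_comm]
    rw [this, Matrix.mul_nonsing_inv _ hu]
    simp [Matrix.one_apply]
  have hdual : ∀ f : Fin d → Fin d, volForm g o b (fun m => dualFrame g b (f m)) =
      c * ((gram g b).det)⁻¹ * permSign f := by
    intro f
    have hT : b.toMatrix (dualFrame g b) = ((gram g b)⁻¹).transpose := by
      ext m n
      simp [Module.Basis.toMatrix_apply, dualFrame, Finsupp.single_apply]
    have hD : b.det (dualFrame g b) = ((gram g b).det)⁻¹ := by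
      rw [b.det_apply, hT, Matrix.det_transpose, Matrix.det_nonsing_inv, Ring.inverse_eq_inv']
    by_cases hf : Function.Injective f
    · have hp := permSign_perm (Equiv.ofBijective f (Finite.injective_iff_bijective.mp hf))
      rw [Equiv.coe_ofBijective] at hp
      have := b.det.map_perm (dualFrame g b)
        (Equiv.ofBijective f (Finite.injective_iff_bijective.mp hf))
      rw [hD] at this
      have h2 : b.det (fun m => dualFrame g b (f m)) = permSign f * ((gram g b).det)⁻¹ := by
        rw [hp, ← zsmul_eq_mul, ← Units.smul_def, ← this]
        rfl
      simp only [volForm, AlternatingMap.smul_apply, smul_eq_mul, h2]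
      ring
    · rw [permSign_eq_zero hf, mul_zero]
      refine AlternatingMap.map_eq_zero_of_not_injective _ _ fun h => hf fun x y hxy => h ?_
      simp [hxy]
  have hinner : ∀ i : Fin k → Fin d, star h₁ g o b μ (fun a => dualFrame g b (i a)) =
      (l.factorial : ℝ)⁻¹ * (c * ((gram g b).det)⁻¹ * (-1) ^ (k * l)) * ∑ j : Fin l → Fin d,
        permSign (cat h₂ i j) * μ (fun a => b (j a)) := by
    intro i
    have := sum_contract μ.toAlternatingMap.toMultilinearMap
      (insertFirst h₂ (volForm g o b) (fun a => dualFrame g b (i a))).toMultilinearMap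
      (gram g b)⁻¹ (gram g b)
      (by rw [Matrix.transpose_nonsing_inv, gram_transpose g hs, Matrix.nonsing_inv_mul _ hu])
      b (dualFrame g b)
    simp only [← hlow] at this
    have e : ∀ j : Fin l → Fin d, volForm g o b
        (cat h₁ (fun a => b (j a)) (fun a => dualFrame g b (i a))) = (-1) ^ (l * k) *
        (insertFirst h₂ (volForm g o b) (fun a => dualFrame g b (i a))).toMultilinearMap
          (fun a => b (j a)) := fun j => map_cat_swap h₁ h₂ _ _ _
    have e2 : ∀ j : Fin l → Fin d,
        (insertFirst h₂ (volForm g o b) (fun a => dualFrame g b (i a))).toMultilinearMap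
          (dualFrame g b ∘ j) = c * ((gram g b).det)⁻¹ * permSign (cat h₂ i j) := by
      intro j
      rw [← hdual, comp_cat (dualFrame g b)]
      rfl
    simp_rw [e2] at this
    have e3 : ∑ j : Fin l → Fin d, μ (fun a => dualFrame g b (j a)) * volForm g o b
        (cat h₁ (fun a => b (j a)) (fun a => dualFrame g b (i a))) = (-1) ^ (l * k) *
          ∑ j : Fin l → Fin d, μ (fun a => b (j a)) *
            (c * ((gram g b).det)⁻¹ * permSign (cat h₂ i j)) := by
      refine Eq.trans ?_ (congrArg _ this)
      rw [Finset.mul_sum]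
      refine Finset.sum_congr rfl fun j _ => ?_
      rw [e, mul_left_comm]
      rfl
    rw [star_apply, e3, Finset.mul_sum, Finset.mul_sum, Finset.mul_sum, mul_comm l k]
    exact Finset.sum_congr rfl fun j _ => by ring
  refine ext_basis b fun j' => ?_
  rw [star_apply]
  simp_rw [hinner, ← comp_cat b, volForm_basis_comp, ← hc]
  have key := sum_permSign_permSign h₂ j' (fun j => μ (fun a => b (j a)))
    (fun j hj => μ.toAlternatingMap.map_eq_zero_of_not_injective _ fun h =>
      hj fun x y hxy => h (by simp [hxy]))
    (fun j π => by
      have := μ.toAlternatingMap.map_perm (fun a => b (j a)) π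
      rw [← zsmul_eq_mul, ← Units.smul_def]
      exact this)
  have hsum : ∑ i : Fin k → Fin d, (l.factorial : ℝ)⁻¹ * (c * ((gram g b).det)⁻¹ * (-1) ^ (k * l)) *
      (∑ j : Fin l → Fin d, permSign (cat h₂ i j) * μ (fun a => b (j a))) *
        (c * permSign (cat h₂ i j')) = (l.factorial : ℝ)⁻¹ * (c * c * ((gram g b).det)⁻¹ *
          (-1) ^ (k * l)) * (k.factorial * l.factorial * μ (fun a => b (j' a))) := by
    rw [← key, Finset.mul_sum]
    refine Finset.sum_congr rfl fun i _ => ?_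
    simp_rw [Finset.mul_sum, Finset.sum_mul]
    exact Finset.sum_congr rfl fun j _ => by ring
  rw [hsum]
  have hcc : c * c * ((gram g b).det)⁻¹ = (SignType.sign (gram g b).det : ℝ) := by
    have : c * c = |(gram g b).det| := by
      rw [hc, mul_mul_mul_comm, orientSign_sq, one_mul, Real.mul_self_sqrt (abs_nonneg _)]
    rw [this, ← div_eq_mul_inv, div_eq_iff hdet, sign_mul_self]
  rw [hcc]
  have hk : (k.factorial : ℝ) ≠ 0 := by positivity
  have hl : (l.factorial : ℝ) ≠ 0 := by positivity
  simp only [ContinuousAlternatingMap.smul_apply, smul_eq_mul]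
  field_simp

/-- The wedge pairing of complementary degrees is nondegenerate. -/
theorem eq_zero_of_wedge_eq_zero (h : k + l = d) (b : Module.Basis (Fin d) ℝ V)
    (μ : V [⋀^Fin l]→L[ℝ] ℝ) (hμ : ∀ α : V [⋀^Fin k]→L[ℝ] ℝ, wedge h α μ b = 0) : μ = 0 := by
  have h' : l + k = d := by omega
  refine ext_basis b fun j' => ?_
  -- the test form with the Levi-Civita symbols `ε_{j' i}` as components picks out the component
  -- of `μ` at `j'`
  have := hμ (toCont (insertFirst h' b.det (fun a => b (j' a))))
  rw [wedge_basis] at this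
  have key := sum_permSign_permSign h j' (fun j => μ (fun a => b (j a)))
    (fun j hj => μ.toAlternatingMap.map_eq_zero_of_not_injective _ fun h =>
      hj fun x y hxy => h (by simp [hxy]))
    (fun j π => by
      have := μ.toAlternatingMap.map_perm (fun a => b (j a)) π
      rw [← zsmul_eq_mul, ← Units.smul_def]
      exact this)
  have hi : ∀ i : Fin k → Fin d, toCont (insertFirst h' b.det (fun a => b (j' a)))
      (fun a => b (i a)) = (-1) ^ (l * k) * permSign (cat h i j') := by
    intro i
    rw [toCont_apply, insertFirst_apply, ← comp_cat b, det_basis_comp, permSign_cat_swap h' h]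
  have h2 : ∑ i : Fin k → Fin d, ∑ j : Fin l → Fin d, permSign (cat h i j) *
      (((-1) ^ (l * k) * permSign (cat h i j')) * μ (fun a => b (j a))) =
      (-1) ^ (l * k) * (k.factorial * l.factorial * μ (fun a => b (j' a))) := by
    rw [← key, Finset.mul_sum]
    refine Finset.sum_congr rfl fun i _ => ?_
    rw [Finset.mul_sum]
    exact Finset.sum_congr rfl fun j _ => by ring
  simp_rw [hi] at this
  rw [h2] at this
  have hk : (k.factorial : ℝ) ≠ 0 := by positivity
  have hl : (l.factorial : ℝ) ≠ 0 := by positivity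
  simpa [hk, hl] using this

end WedgeStar

/-! ### Smooth families of alternating forms -/

section SmoothAlternating

variable {d k l n : ℕ} {F : Type*} [NormedAddCommGroup F] [NormedSpace ℝ F]

/-- A map into alternating forms is smooth as soon as its components are. -/
theorem contDiffAt_alternating {α : F → E d [⋀^Fin k]→L[ℝ] ℝ} {y : F}
    (h : ∀ j : Fin k → Fin d, ContDiffAt ℝ ∞ (fun z => α z fun a => stdBasis d (j a)) y) :
    ContDiffAt ℝ ∞ α y := by
  let ev : E d [⋀^Fin k]→L[ℝ] ℝ →ₗ[ℝ] (Fin k → Fin d) → ℝ :=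
    LinearMap.pi fun j => (ContinuousAlternatingMap.apply ℝ (E d) ℝ
      fun a => stdBasis d (j a)).toLinearMap
  have hev : LinearMap.ker ev = ⊥ := by
    refine LinearMap.ker_eq_bot'.mpr fun β hβ => ext_basis (stdBasis d) fun j => ?_
    exact congrFun hβ j
  obtain ⟨g, hg⟩ := ev.exists_leftInverse_of_injective hev
  have h1 : α = fun z => g.toContinuousLinearMap (fun j => α z fun a => stdBasis d (j a)) := by
    funext z
    exact (LinearMap.congr_fun hg (α z)).symm
  rw [h1]
  exact g.toContinuousLinearMap.contDiff.contDiffAt.comp y (contDiffAt_pi.mpr h)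

theorem contDiffAt_alternating_apply {α : F → E d [⋀^Fin k]→L[ℝ] ℝ} {y : F}
    (h : ContDiffAt ℝ ∞ α y) (v : Fin k → E d) : ContDiffAt ℝ ∞ (fun z => α z v) y :=
  (ContinuousAlternatingMap.apply ℝ (E d) ℝ v).contDiff.contDiffAt.comp y h

/-- Pulling back by smoothly varying linear maps preserves smoothness. -/
theorem contDiffAt_compContinuousLinearMap {α : F → E d [⋀^Fin k]→L[ℝ] ℝ}
    {A : F → E d →L[ℝ] E d} {y : F} (hα : ContDiffAt ℝ ∞ α y) (hA : ContDiffAt ℝ ∞ A y) :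
    ContDiffAt ℝ ∞ (fun z => (α z).compContinuousLinearMap (A z)) y := by
  refine contDiffAt_alternating fun j => ?_
  have h1 : (fun z => (α z).compContinuousLinearMap (A z) fun a => stdBasis d (j a)) = fun z =>
      ∑ r : Fin k → Fin d, (∏ i, (stdBasis d).repr (A z (stdBasis d (j i))) (r i)) •
        α z (fun i => stdBasis d (r i)) :=
    funext fun z => apply_eq_sum_repr (stdBasis d) (α z) _
  rw [h1]
  refine ContDiffAt.sum fun r _ => ?_
  refine (contDiffAt_prod fun i _ => ?_ : ContDiffAt ℝ ∞ (fun z =>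
    ∏ i, (stdBasis d).repr (A z (stdBasis d (j i))) (r i)) y).smul
      (contDiffAt_alternating_apply hα _)
  exact (((stdBasis d).coord (r i)).toContinuousLinearMap.contDiff.contDiffAt).comp y
    (hA.clm_apply contDiffAt_const)

theorem contDiffAt_extDeriv {α : E d → E d [⋀^Fin k]→L[ℝ] ℝ} {y : E d}
    (h : ContDiffAt ℝ ∞ α y) : ContDiffAt ℝ ∞ (extDeriv α) y :=
  (ContinuousAlternatingMap.alternatizeUncurryFinCLM ℝ (E d) ℝ).contDiff.contDiffAt.comp y
    (h.fderiv_right (by simp))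

end SmoothAlternating

theorem two_le_infty : (2 : WithTop ℕ∞) ≤ ∞ :=
  WithTop.coe_le_coe.mpr (le_top : (2 : ℕ∞) ≤ ⊤)

/-! ### Coordinate expressions of forms -/

section ChartCalculus

variable {d : ℕ} {M : Type*} [TopologicalSpace M] [ChartedSpace (E d) M]

theorem mfderivWithin_range_eq (i : M) (y : E d) :
    mfderivWithin 𝓘(ℝ, E d) (𝓡 d) (extChartAt (𝓡 d) i).symm (range (𝓡 d)) y =
      mfderiv 𝓘(ℝ, E d) (𝓡 d) (extChartAt (𝓡 d) i).symm y := by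
  rw [(𝓡 d).range_eq_univ, mfderivWithin_univ]

/-- The derivative of the inverse of the chart at `i`, as an endomorphism of the model space. -/
def chartSymmDeriv (i : M) (y : E d) : E d →L[ℝ] E d :=
  mfderiv 𝓘(ℝ, E d) (𝓡 d) (extChartAt (𝓡 d) i).symm y

/-- The value of a form at a point, as a form on the model space. -/
def formAt {k : ℕ} (θ : DForm d M k) (x : M) : E d [⋀^Fin k]→L[ℝ] ℝ := θ x

theorem chartRep_eq {k : ℕ} (i : M) (θ : DForm d M k) (y : E d) :
    chartRep i θ y =
      (formAt θ ((extChartAt (𝓡 d) i).symm y)).compContinuousLinearMap (chartSymmDeriv i y) := rfl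

/-- The transition map from the chart at `i` to the chart at `j`. -/
def transition (i j : M) : E d → E d := extChartAt (𝓡 d) j ∘ (extChartAt (𝓡 d) i).symm

/-- The domain of the transition map from the chart at `i` to the chart at `j`. -/
def overlap (d : ℕ) {M : Type*} [TopologicalSpace M] [ChartedSpace (E d) M] (i j : M) :
    Set (E d) :=
  (extChartAt (𝓡 d) i).target ∩ (extChartAt (𝓡 d) i).symm ⁻¹' (extChartAt (𝓡 d) j).source

theorem isOpen_overlap (i j : M) : IsOpen (overlap d i j) :=
  (continuousOn_extChartAt_symm i).isOpen_inter_preimage (isOpen_extChartAt_target i)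
    (isOpen_extChartAt_source j)

theorem transition_mem_overlap {i j : M} {y : E d} (hy : y ∈ overlap d i j) :
    transition i j y ∈ overlap d j i := by
  refine ⟨(extChartAt (𝓡 d) j).map_source hy.2, ?_⟩
  simp only [transition, mem_preimage, Function.comp_apply]
  rw [(extChartAt (𝓡 d) j).left_inv hy.2]
  exact (extChartAt (𝓡 d) i).map_target hy.1

theorem symm_transition {i j : M} {y : E d} (hy : y ∈ overlap d i j) :
    (extChartAt (𝓡 d) j).symm (transition i j y) = (extChartAt (𝓡 d) i).symm y :=
  (extChartAt (𝓡 d) j).left_inv hy.2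

theorem transition_transition {i j : M} {y : E d} (hy : y ∈ overlap d i j) :
    transition j i (transition i j y) = y := by
  rw [transition, Function.comp_apply, symm_transition hy, (extChartAt (𝓡 d) i).right_inv hy.1]

theorem overlap_self_mem {i x : M} (hx : x ∈ (extChartAt (𝓡 d) i).source) :
    extChartAt (𝓡 d) x x ∈ overlap d x i :=
  ⟨mem_extChartAt_target x, by simpa using hx⟩

theorem overlap_mem {i : M} {y : E d} (hy : y ∈ (extChartAt (𝓡 d) i).target) :
    y ∈ overlap d i ((extChartAt (𝓡 d) i).symm y) := ⟨hy, mem_extChartAt_source _⟩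

theorem IsSmooth.contDiffAt {k : ℕ} {θ : DForm d M k} (hθ : IsSmooth θ) {i : M} {y : E d}
    (hy : y ∈ (extChartAt (𝓡 d) i).target) : ContDiffAt ℝ ∞ (chartRep i θ) y :=
  (hθ i).contDiffAt ((isOpen_extChartAt_target i).mem_nhds hy)

variable [IsManifold (𝓡 d) ∞ M]

instance : IsManifold (𝓡 d) 1 M := IsManifold.of_le (n := ∞) (by simp)

theorem chartSymmDeriv_self (x : M) :
    chartSymmDeriv x (extChartAt (𝓡 d) x x) = ContinuousLinearMap.id ℝ (E d) := by
  have := mfderivWithin_range_extChartAt_symm (I := 𝓡 d) (x := x)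
  rw [mfderivWithin_range_eq] at this
  exact this

theorem mdifferentiableAt_chart_symm (i : M) {y : E d} (hy : y ∈ (extChartAt (𝓡 d) i).target) :
    MDifferentiableAt 𝓘(ℝ, E d) (𝓡 d) (extChartAt (𝓡 d) i).symm y := by
  have := mdifferentiableWithinAt_extChartAt_symm (I := 𝓡 d) hy
  rwa [(𝓡 d).range_eq_univ, mdifferentiableWithinAt_univ] at this

theorem contDiffOn_transition (i j : M) : ContDiffOn ℝ ∞ (transition i j) (overlap d i j) := by
  refine (contDiffOn_ext_coord_change (I := 𝓡 d) (n := ∞) j i).mono fun y hy => ?_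
  simpa [overlap] using hy

theorem contDiffAt_transition {i j : M} {y : E d} (hy : y ∈ overlap d i j) :
    ContDiffAt ℝ ∞ (transition i j) y :=
  (contDiffOn_transition i j).contDiffAt ((isOpen_overlap i j).mem_nhds hy)

theorem chartSymmDeriv_transition {i j : M} {y : E d} (hy : y ∈ overlap d i j) :
    chartSymmDeriv i y =
      (chartSymmDeriv j (transition i j y)).comp (fderiv ℝ (transition i j) y) := by
  have h1 : mfderiv 𝓘(ℝ, E d) (𝓡 d) (extChartAt (𝓡 d) i).symm y =
      mfderiv 𝓘(ℝ, E d) (𝓡 d) ((extChartAt (𝓡 d) j).symm ∘ transition i j) y := by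
    refine Filter.EventuallyEq.mfderiv_eq ?_
    filter_upwards [(isOpen_overlap i j).mem_nhds hy] with z hz
    exact (symm_transition hz).symm
  have h2 := mfderiv_comp (I := 𝓘(ℝ, E d)) (I' := 𝓘(ℝ, E d)) (I'' := 𝓡 d) y
    (mdifferentiableAt_chart_symm j (transition_mem_overlap hy).1)
    ((contDiffAt_transition hy).differentiableAt (by simp)).mdifferentiableAt
  rw [mfderiv_eq_fderiv] at h2
  exact h1.trans h2

/-- The transformation law of the coordinate expressions of a form. -/
theorem chartRep_transition {k : ℕ} (θ : DForm d M k) {i j : M} {y : E d}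
    (hy : y ∈ overlap d i j) :
    chartRep i θ y =
      (chartRep j θ (transition i j y)).compContinuousLinearMap (fderiv ℝ (transition i j) y) := by
  rw [chartRep_eq, chartRep_eq, symm_transition hy, chartSymmDeriv_transition hy]
  rfl

/-- The derivative of the inverse of a chart, as a linear isomorphism. -/
theorem chartSymmDeriv_inverse (i : M) {y : E d} (hy : y ∈ (extChartAt (𝓡 d) i).target) :
    ∃ e : E d ≃L[ℝ] E d, (e : E d →L[ℝ] E d) = chartSymmDeriv i y := by
  have h := isInvertible_mfderivWithin_extChartAt_symm (I := 𝓡 d) hy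
  rw [mfderivWithin_range_eq] at h
  obtain ⟨e, he⟩ := h
  exact ⟨e, he⟩

theorem formAt_eq {k : ℕ} (θ : DForm d M k) (x : M) :
    formAt θ x = chartRep x θ (extChartAt (𝓡 d) x x) := by
  rw [chartRep_eq, extChartAt_to_inv, chartSymmDeriv_self]
  rfl

theorem eq_zero_iff_chartRep {k : ℕ} (θ : DForm d M k) {i : M} {y : E d}
    (hy : y ∈ (extChartAt (𝓡 d) i).target) :
    chartRep i θ y = 0 ↔ θ ((extChartAt (𝓡 d) i).symm y) = 0 := by
  obtain ⟨e, he⟩ := chartSymmDeriv_inverse i hy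
  have h0 : θ ((extChartAt (𝓡 d) i).symm y) = 0 ↔ formAt θ ((extChartAt (𝓡 d) i).symm y) = 0 :=
    Iff.rfl
  rw [h0, chartRep_eq, ← he]
  refine ⟨fun h => ?_, fun h => by rw [h]; rfl⟩
  ext v
  have := congrArg (fun α : E d [⋀^Fin k]→L[ℝ] ℝ => α (fun a => e.symm (v a))) h
  simpa [Function.comp_def] using this

/-- Smoothness at each point can be tested in the chart at that point. -/
theorem isSmooth_of_forall {k : ℕ} {θ : DForm d M k}
    (h : ∀ x : M, ContDiffAt ℝ ∞ (chartRep x θ) (extChartAt (𝓡 d) x x)) : IsSmooth θ := by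
  intro i y hy
  have hov := overlap_mem hy
  set x := (extChartAt (𝓡 d) i).symm y with hx
  refine ContDiffAt.contDiffWithinAt ?_
  have ht : transition i x y = extChartAt (𝓡 d) x x := rfl
  have h1 : chartRep i θ =ᶠ[𝓝 y] fun z =>
      (chartRep x θ (transition i x z)).compContinuousLinearMap (fderiv ℝ (transition i x) z) := by
    filter_upwards [(isOpen_overlap i x).mem_nhds hov] with z hz
    exact chartRep_transition θ hz
  refine ContDiffAt.congr_of_eventuallyEq ?_ h1
  refine contDiffAt_compContinuousLinearMap ?_ ?_
  · exact (ht ▸ h x : ContDiffAt ℝ ∞ (chartRep x θ) (transition i x y)).comp y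
      (contDiffAt_transition hov)
  · exact (contDiffAt_transition hov).fderiv_right (by simp)

/-- The exterior derivative is computed in any chart. -/
theorem chartRep_extD {k : ℕ} {θ : DForm d M k} (hθ : IsSmooth θ) {i : M} {y : E d}
    (hy : y ∈ (extChartAt (𝓡 d) i).target) :
    chartRep i (extD θ) y = extDeriv (chartRep i θ) y := by
  have hov := overlap_mem hy
  set x := (extChartAt (𝓡 d) i).symm y with hx
  have ht : transition i x y = extChartAt (𝓡 d) x x := rfl
  have h0 : formAt (extD θ) x = extDeriv (chartRep x θ) (extChartAt (𝓡 d) x x) := by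
    have : mfderiv (𝓡 d) 𝓘(ℝ, E d) (extChartAt (𝓡 d) x) x = ContinuousLinearMap.id ℝ (E d) :=
      mfderiv_extChartAt_self
    have h2 : formAt (extD θ) x = (extDeriv (chartRep x θ)
      (extChartAt (𝓡 d) x x)).compContinuousLinearMap
        (mfderiv (𝓡 d) 𝓘(ℝ, E d) (extChartAt (𝓡 d) x) x) := rfl
    rw [h2, this]
    rfl
  have h1 : chartRep i θ =ᶠ[𝓝 y] fun z =>
      (chartRep x θ (transition i x z)).compContinuousLinearMap (fderiv ℝ (transition i x) z) := by
    filter_upwards [(isOpen_overlap i x).mem_nhds hov] with z hz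
    exact chartRep_transition θ hz
  rw [h1.extDeriv_eq, extDeriv_pullback (r := 2)
    ((hθ.contDiffAt (transition_mem_overlap hov).1).differentiableAt (by simp))
    ((contDiffAt_transition hov).of_le two_le_infty) (by simp), chartRep_transition _ hov]
  congr 1
  rw [ht, ← h0, formAt_eq]

end ChartCalculus

/-! ### Smoothness of the Hodge star -/

section SmoothMatrix

variable {d : ℕ} {F : Type*} [NormedAddCommGroup F] [NormedSpace ℝ F]

theorem contDiffAt_det {A : F → Matrix (Fin d) (Fin d) ℝ} {y : F}
    (h : ∀ a b, ContDiffAt ℝ ∞ (fun z => A z a b) y) : ContDiffAt ℝ ∞ (fun z => (A z).det) y := by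
  simp only [Matrix.det_apply, Units.smul_def, zsmul_eq_mul]
  exact ContDiffAt.sum fun σ _ => contDiffAt_const.mul (contDiffAt_prod fun i _ => h _ _)

theorem contDiffAt_inv {A : F → Matrix (Fin d) (Fin d) ℝ} {y : F}
    (h : ∀ a b, ContDiffAt ℝ ∞ (fun z => A z a b) y) (h0 : (A y).det ≠ 0) (a b : Fin d) :
    ContDiffAt ℝ ∞ (fun z => (A z)⁻¹ a b) y := by
  simp only [Matrix.inv_def, Matrix.smul_apply, Ring.inverse_eq_inv', Matrix.adjugate_apply,
    smul_eq_mul]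
  refine ((contDiffAt_det h).inv h0).mul (contDiffAt_det fun p q => ?_)
  by_cases hp : p = b
  · subst hp
    simp only [Matrix.updateRow_self]
    exact contDiffAt_const
  · simp only [Matrix.updateRow_ne hp]
    exact h p q

/-- A continuous function with values `1` and `-1` is locally constant. -/
theorem eventuallyEq_const_of_mul_self {X : Type*} [TopologicalSpace X] {f : X → ℝ} {y : X}
    (hf : ContinuousAt f y)
    (h : ∀ᶠ z in 𝓝 y, f z * f z = 1) : f =ᶠ[𝓝 y] fun _ => f y := by
  filter_upwards [h, hf.eventually (Metric.ball_mem_nhds (f y) one_pos)] with z hz hd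
  have hy := h.self_of_nhds
  replace hd : |f z - f y| < 1 := hd
  rcases mul_self_eq_one_iff.mp hz with h1 | h1 <;>
    rcases mul_self_eq_one_iff.mp hy with h2 | h2 <;>
    simp only [h1, h2] at hd ⊢ <;> norm_num at hd

theorem eventuallyEq_sign {X : Type*} [TopologicalSpace X] {f : X → ℝ} {y : X}
    (hf : ContinuousAt f y) (h0 : f y ≠ 0) :
    (fun z => (SignType.sign (f z) : ℝ)) =ᶠ[𝓝 y] fun _ => (SignType.sign (f y) : ℝ) := by
  rcases h0.lt_or_gt with h | h
  · filter_upwards [hf.eventually (gt_mem_nhds h)] with z hz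
    rw [sign_neg h, sign_neg hz]
  · filter_upwards [hf.eventually (lt_mem_nhds h)] with z hz
    rw [sign_pos h, sign_pos hz]

end SmoothMatrix

section HodgeChart

variable {d : ℕ} {M : Type*} [TopologicalSpace M] [ChartedSpace (E d) M]
  [IsManifold (𝓡 d) ∞ M]

/-- The coordinate frame is a basis of the tangent space. -/
theorem exists_chartBasis (i : M) {y : E d} (hy : y ∈ (extChartAt (𝓡 d) i).target) :
    ∃ b : Module.Basis (Fin d) ℝ (TangentSpace (𝓡 d) ((extChartAt (𝓡 d) i).symm y)),
      ⇑b = chartFrame i y := by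
  obtain ⟨e, he⟩ := chartSymmDeriv_inverse i hy
  refine ⟨(stdBasis d).map e.toLinearEquiv, ?_⟩
  funext a
  exact congrArg (fun A : E d →L[ℝ] E d => A (stdBasis d a)) he

/-- The Gram matrix of the coordinate frame of the chart at `i`. -/
def chartGram (g : PseudoRiemannianMetric d M) (i : M) (y : E d) : Matrix (Fin d) (Fin d) ℝ :=
  Matrix.of fun a b =>
    g.val ((extChartAt (𝓡 d) i).symm y) (chartFrame i y a) (chartFrame i y b)

theorem gram_eq_chartGram (g : PseudoRiemannianMetric d M) (i : M) (y : E d)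
    (b : Module.Basis (Fin d) ℝ (TangentSpace (𝓡 d) ((extChartAt (𝓡 d) i).symm y)))
    (hb : ⇑b = chartFrame i y) :
    gram (g.val ((extChartAt (𝓡 d) i).symm y)) b = chartGram g i y := by
  simp only [gram, chartGram, hb]

theorem chartGram_det_ne_zero (g : PseudoRiemannianMetric d M) (i : M) {y : E d}
    (hy : y ∈ (extChartAt (𝓡 d) i).target) : (chartGram g i y).det ≠ 0 := by
  obtain ⟨b, hb⟩ := exists_chartBasis i hy
  rw [← gram_eq_chartGram g i y b hb]
  exact gram_det_ne_zero _ (g.nondegenerate _) b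

theorem metricSign_eq (g : PseudoRiemannianMetric d M) (i : M) {y : E d}
    (hy : y ∈ (extChartAt (𝓡 d) i).target) :
    metricSign g ((extChartAt (𝓡 d) i).symm y) = (SignType.sign (chartGram g i y).det : ℝ) := by
  obtain ⟨b, hb⟩ := exists_chartBasis i hy
  rw [← gram_eq_chartGram g i y b hb, metricSign, sign_gram_det _ b]

/-- The sign of the coordinate frame of the chart at `i`. -/
def chartSign (o : ManifoldOrientation d M) (i : M) (y : E d) : ℝ :=
  orientSign (o.orient ((extChartAt (𝓡 d) i).symm y)) (chartFrame i y)

theorem chartSign_mul_self (o : ManifoldOrientation d M) (i : M) {y : E d}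
    (hy : y ∈ (extChartAt (𝓡 d) i).target) : chartSign o i y * chartSign o i y = 1 := by
  obtain ⟨b, hb⟩ := exists_chartBasis i hy
  rw [chartSign, ← hb]
  exact orientSign_sq _ b

theorem chartSign_eventuallyEq (o : ManifoldOrientation d M) (i : M) {y : E d}
    (hy : y ∈ (extChartAt (𝓡 d) i).target) :
    chartSign o i =ᶠ[𝓝 y] fun _ => chartSign o i y := by
  have hn := (isOpen_extChartAt_target (I := 𝓡 d) i).mem_nhds hy
  refine eventuallyEq_const_of_mul_self ((o.locallyConstant i).continuousAt hn) ?_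
  filter_upwards [hn] with z hz
  exact chartSign_mul_self o i hz

/-- The Hodge star in the coordinates of a chart. -/
theorem chartRep_hodgeStar (g : PseudoRiemannianMetric d M) (o : ManifoldOrientation d M) {k l : ℕ}
    (h : k + l = d) (β : DForm d M k) (i : M) {y : E d} (hy : y ∈ (extChartAt (𝓡 d) i).target)
    (j : Fin l → Fin d) :
    chartRep i (hodgeStar g o h β) y (fun a => stdBasis d (j a)) = (k.factorial : ℝ)⁻¹ *
      ∑ m : Fin k → Fin d, (∑ r : Fin k → Fin d, (∏ a, (chartGram g i y)⁻¹ (m a) (r a)) *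
        chartRep i β y (fun a => stdBasis d (r a))) *
          (chartSign o i y * Real.sqrt |(chartGram g i y).det| * permSign (cat h m j)) := by
  obtain ⟨b, hb⟩ := exists_chartBasis i hy
  have h1 : chartRep i (hodgeStar g o h β) y (fun a => stdBasis d (j a)) =
      star h (g.val _) (o.orient _) (tangentBasis _) (β ((extChartAt (𝓡 d) i).symm y))
        (fun a => b (j a)) := by
    rw [hb]
    rfl
  have h2 : ∀ r : Fin k → Fin d, chartRep i β y (fun a => stdBasis d (r a)) =
      β ((extChartAt (𝓡 d) i).symm y) (fun a => b (r a)) := by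
    intro r
    rw [hb]
    rfl
  rw [h1, star_eq _ h _ b (tangentBasis _), star_basis,
    gram_eq_chartGram g i y b hb]
  simp_rw [h2, chartSign, ← hb]

/-- The coordinate frame consists of smooth vector fields. -/
theorem contMDiffAt_chartFrame (i : M) {y : E d} (hy : y ∈ (extChartAt (𝓡 d) i).target)
    (a : Fin d) :
    ContMDiffAt 𝓘(ℝ, E d) ((𝓡 d).prod 𝓘(ℝ, E d)) ∞ (fun z => Bundle.TotalSpace.mk' (E d)
      (E := fun x : M => TangentSpace (𝓡 d) x) ((extChartAt (𝓡 d) i).symm z)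
        (chartFrame i z a)) y := by
  have hψ : ContMDiffAt 𝓘(ℝ, E d) (𝓡 d) ∞ (extChartAt (𝓡 d) i).symm y :=
    (contMDiffOn_extChartAt_symm i).contMDiffAt ((isOpen_extChartAt_target i).mem_nhds hy)
  have hmem : ∀ z ∈ (extChartAt (𝓡 d) i).target,
      (extChartAt (𝓡 d) i).symm z ∈ (chartAt (E d) i).source := by
    intro z hz
    rw [← extChartAt_source (𝓡 d)]
    exact (extChartAt (𝓡 d) i).map_target hz
  rw [Bundle.Trivialization.contMDiffAt_iff
    (e := trivializationAt (E d) (fun x : M => TangentSpace (𝓡 d) x) i)]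
  · refine ⟨hψ, ?_⟩
    refine (contMDiffAt_const (c := stdBasis d a)).congr_of_eventuallyEq ?_
    filter_upwards [(isOpen_extChartAt_target i).mem_nhds hy] with z hz
    have hb : (extChartAt (𝓡 d) i).symm z ∈
        (trivializationAt (E d) (fun x : M => TangentSpace (𝓡 d) x) i).baseSet := by
      simpa using hmem z hz
    have h1 := TangentBundle.continuousLinearMapAt_trivializationAt (I := 𝓡 d) (hmem z hz)
    have h2 := mfderiv_extChartAt_comp_mfderivWithin_extChartAt_symm (I := 𝓡 d) hz
    rw [mfderivWithin_range_eq] at h2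
    have h3 := congrArg (fun A => A (stdBasis d a)) h2
    rw [← h1] at h3
    refine Eq.trans ?_ h3
    have h4 := (trivializationAt (E d) (fun x : M => TangentSpace (𝓡 d) x) i).coe_linearMapAt_of_mem
      (R := ℝ) hb
    exact (congrFun h4 (chartFrame i z a)).symm
  · simpa [Bundle.Trivialization.mem_source] using hmem y hy

theorem contDiffAt_chartGram (g : PseudoRiemannianMetric d M) (i : M) {y : E d}
    (hy : y ∈ (extChartAt (𝓡 d) i).target) (a b : Fin d) :
    ContDiffAt ℝ ∞ (fun z => chartGram g i z a b) y := by
  have hψ : ContMDiffAt 𝓘(ℝ, E d) (𝓡 d) ∞ (extChartAt (𝓡 d) i).symm y :=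
    (contMDiffOn_extChartAt_symm i).contMDiffAt ((isOpen_extChartAt_target i).mem_nhds hy)
  have hg := (g.contMDiff ((extChartAt (𝓡 d) i).symm y)).comp y hψ
  have := ContMDiffAt.clm_bundle_apply₂ (F₁ := E d) (F₂ := E d) (F₃ := ℝ)
    (E₁ := fun x : M => TangentSpace (𝓡 d) x) (E₂ := fun x : M => TangentSpace (𝓡 d) x)
    (E₃ := Bundle.Trivial M ℝ) (b := (extChartAt (𝓡 d) i).symm)
    hg (contMDiffAt_chartFrame i hy a) (contMDiffAt_chartFrame i hy b)
  rw [Bundle.contMDiffAt_totalSpace] at this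
  exact this.2.contDiffAt

theorem contDiffAt_chartSign (o : ManifoldOrientation d M) (i : M) {y : E d}
    (hy : y ∈ (extChartAt (𝓡 d) i).target) : ContDiffAt ℝ ∞ (chartSign o i) y :=
  contDiffAt_const.congr_of_eventuallyEq (chartSign_eventuallyEq o i hy)

theorem IsSmooth.hodgeStar (g : PseudoRiemannianMetric d M) (o : ManifoldOrientation d M) {k l : ℕ}
    (h : k + l = d) {β : DForm d M k} (hβ : IsSmooth β) :
    IsSmooth (TwistedHodge.hodgeStar g o h β) := by
  intro i y hy
  refine (contDiffAt_alternating fun j => ?_).contDiffWithinAt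
  have hn := (isOpen_extChartAt_target (I := 𝓡 d) i).mem_nhds hy
  refine ContDiffAt.congr_of_eventuallyEq ?_
    (Filter.eventually_of_mem hn fun z hz => chartRep_hodgeStar g o h β i hz j)
  have hG := contDiffAt_chartGram g i hy
  have hdet := chartGram_det_ne_zero g i hy
  have hsqrt : ContDiffAt ℝ ∞ (fun z => Real.sqrt |(chartGram g i z).det|) y :=
    ContDiffAt.sqrt (f := fun z => |(chartGram g i z).det|)
      (ContDiffAt.comp y (contDiffAt_abs hdet) (contDiffAt_det hG)) (abs_pos.mpr hdet).ne'
  refine contDiffAt_const.mul (ContDiffAt.sum fun m _ => ContDiffAt.mul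
    (ContDiffAt.sum fun r _ => ContDiffAt.mul (contDiffAt_prod fun a _ => ?_) ?_)
      (((contDiffAt_chartSign o i hy).mul hsqrt).mul contDiffAt_const))
  · exact contDiffAt_inv hG hdet _ _
  · exact contDiffAt_alternating_apply (hβ.contDiffAt hy) _

end HodgeChart

/-! ### Linearity of the wedge product and of the Hodge star -/

section WedgeLinear

variable {V : Type*} [AddCommGroup V] [Module ℝ V] [TopologicalSpace V]
  [IsTopologicalAddGroup V] [ContinuousSMul ℝ V] [T2Space V] [FiniteDimensional ℝ V] {d k l n : ℕ}

theorem wedge_smul_left (h : k + l = n) (c : ℝ) (α : V [⋀^Fin k]→L[ℝ] ℝ)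
    (β : V [⋀^Fin l]→L[ℝ] ℝ) : wedge h (c • α) β = c • wedge h α β := by
  ext v
  simp only [ContinuousAlternatingMap.smul_apply, wedge_apply, smul_eq_mul, Finset.mul_sum]
  exact Finset.sum_congr rfl fun σ _ => by ring

theorem wedge_smul_right (h : k + l = n) (c : ℝ) (α : V [⋀^Fin k]→L[ℝ] ℝ)
    (β : V [⋀^Fin l]→L[ℝ] ℝ) : wedge h α (c • β) = c • wedge h α β := by
  ext v
  simp only [ContinuousAlternatingMap.smul_apply, wedge_apply, smul_eq_mul, Finset.mul_sum]
  exact Finset.sum_congr rfl fun σ _ => by ring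

theorem wedge_add_left (h : k + l = n) (α α' : V [⋀^Fin k]→L[ℝ] ℝ) (β : V [⋀^Fin l]→L[ℝ] ℝ) :
    wedge h (α + α') β = wedge h α β + wedge h α' β := by
  ext v
  rw [ContinuousAlternatingMap.add_apply, wedge_apply, wedge_apply, wedge_apply, ← mul_add,
    ← Finset.sum_add_distrib]
  refine congrArg _ (Finset.sum_congr rfl fun σ _ => ?_)
  rw [ContinuousAlternatingMap.add_apply]
  ring

theorem wedge_add_right (h : k + l = n) (α : V [⋀^Fin k]→L[ℝ] ℝ) (β β' : V [⋀^Fin l]→L[ℝ] ℝ) :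
    wedge h α (β + β') = wedge h α β + wedge h α β' := by
  ext v
  rw [ContinuousAlternatingMap.add_apply, wedge_apply, wedge_apply, wedge_apply, ← mul_add,
    ← Finset.sum_add_distrib]
  refine congrArg _ (Finset.sum_congr rfl fun σ _ => ?_)
  rw [ContinuousAlternatingMap.add_apply]
  ring

theorem wedge_zero_left (h : k + l = n) (β : V [⋀^Fin l]→L[ℝ] ℝ) :
    wedge h (0 : V [⋀^Fin k]→L[ℝ] ℝ) β = 0 := by
  simpa using wedge_smul_left h 0 0 β

theorem wedge_zero_right (h : k + l = n) (α : V [⋀^Fin k]→L[ℝ] ℝ) :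
    wedge h α (0 : V [⋀^Fin l]→L[ℝ] ℝ) = 0 := by
  simpa using wedge_smul_right h 0 α 0

theorem star_smul (h : k + l = d) (g : V →L[ℝ] V →L[ℝ] ℝ) (o : Orientation ℝ V (Fin d))
    (b : Module.Basis (Fin d) ℝ V) (c : ℝ) (β : V [⋀^Fin k]→L[ℝ] ℝ) :
    star h g o b (c • β) = c • star h g o b β := by
  ext v
  simp only [ContinuousAlternatingMap.smul_apply, star_apply, smul_eq_mul, Finset.mul_sum]
  exact Finset.sum_congr rfl fun σ _ => by ring

theorem star_zero (h : k + l = d) (g : V →L[ℝ] V →L[ℝ] ℝ) (o : Orientation ℝ V (Fin d))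
    (b : Module.Basis (Fin d) ℝ V) :
    star h g o b (0 : V [⋀^Fin k]→L[ℝ] ℝ) = 0 := by
  simpa using star_smul h g o b 0 0

end WedgeLinear

/-! ### Operations on forms -/

section FormOperations

variable {d : ℕ} {M : Type*} [TopologicalSpace M] [ChartedSpace (E d) M]

/-- The wedge product of two forms. -/
def wedgeForm {k l n : ℕ} (h : k + l = n) (α : DForm d M k) (β : DForm d M l) : DForm d M n :=
  fun x => wedge h (α x) (β x)

theorem wedgeForm_mulForm_right {k l n : ℕ} (h : k + l = n) (f : M → ℝ) (α : DForm d M k)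
    (β : DForm d M l) : wedgeForm h α (mulForm f β) = mulForm f (wedgeForm h α β) :=
  funext fun _ => wedge_smul_right _ _ _ _

theorem wedgeForm_add_right {k l n : ℕ} (h : k + l = n) (α : DForm d M k) (β β' : DForm d M l) :
    wedgeForm h α (β + β') = wedgeForm h α β + wedgeForm h α β' :=
  funext fun _ => wedge_add_right _ _ _ _

theorem mulForm_mulForm {k : ℕ} (f f' : M → ℝ) (θ : DForm d M k) :
    mulForm f (mulForm f' θ) = mulForm (fun x => f x * f' x) θ :=
  funext fun x => smul_smul (f x) (f' x) (θ x)

theorem chartRep_mulForm {k : ℕ} (f : M → ℝ) (θ : DForm d M k) (i : M) (y : E d) :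
    chartRep i (mulForm f θ) y = f ((extChartAt (𝓡 d) i).symm y) • chartRep i θ y := rfl

theorem chartRep_add {k : ℕ} (θ θ' : DForm d M k) (i : M) (y : E d) :
    chartRep i (θ + θ') y = chartRep i θ y + chartRep i θ' y := rfl

theorem chartRep_wedgeForm {k l n : ℕ} (h : k + l = n) (α : DForm d M k) (β : DForm d M l)
    (i : M) (y : E d) :
    chartRep i (wedgeForm h α β) y = wedge h (chartRep i α y) (chartRep i β y) :=
  wedge_compContinuousLinearMap h (formAt α _) (formAt β _) (chartSymmDeriv i y)

theorem eventually_chart_symm {p : M → Prop} {i : M} {y : E d}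
    (hy : y ∈ (extChartAt (𝓡 d) i).target) (h : ∀ᶠ z in 𝓝 ((extChartAt (𝓡 d) i).symm y), p z) :
    ∀ᶠ z in 𝓝 y, p ((extChartAt (𝓡 d) i).symm z) :=
  (continuousAt_extChartAt_symm'' hy).eventually h

theorem chartRep_congr {k : ℕ} {θ θ' : DForm d M k} {i : M} {y : E d}
    (hy : y ∈ (extChartAt (𝓡 d) i).target)
    (h : ∀ᶠ z in 𝓝 ((extChartAt (𝓡 d) i).symm y), θ z = θ' z) :
    chartRep i θ =ᶠ[𝓝 y] chartRep i θ' := by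
  filter_upwards [eventually_chart_symm hy h] with z hz
  simp only [chartRep, hz]

theorem extD_congr {k : ℕ} {θ θ' : DForm d M k} {x : M} (h : ∀ᶠ z in 𝓝 x, θ z = θ' z) :
    extD θ x = extD θ' x := by
  simp only [extD]
  rw [(chartRep_congr (mem_extChartAt_target x) (by rwa [extChartAt_to_inv])).extDeriv_eq]

/-- The exterior derivative commutes with locally constant factors. -/
theorem extD_mulForm {k : ℕ} {f : M → ℝ} {x : M} (h : ∀ᶠ z in 𝓝 x, f z = f x)
    (θ : DForm d M k) : extD (mulForm f θ) x = f x • extD θ x := by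
  have h1 : extD (mulForm f θ) x = extD (mulForm (fun _ => f x) θ) x :=
    extD_congr (h.mono fun z hz => by simp only [mulForm, hz])
  rw [h1]
  have h2 : chartRep x (mulForm (fun _ => f x) θ) = f x • chartRep x θ := rfl
  simp only [extD]
  rw [h2, extDeriv_smul]
  rfl

theorem extD_zero {k : ℕ} : extD (0 : DForm d M k) = 0 := by
  funext x
  have h := extD_mulForm (d := d) (M := M) (k := k) (f := fun _ => 0) (x := x) (by simp) 0
  have h0 : mulForm (fun _ => (0 : ℝ)) (0 : DForm d M k) = 0 := funext fun x => zero_smul ℝ _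
  rw [h0] at h
  rw [h, zero_smul]
  rfl

theorem isSmooth_of_contDiffAt {k : ℕ} {θ : DForm d M k}
    (h : ∀ (i : M) (y : E d), y ∈ (extChartAt (𝓡 d) i).target → ContDiffAt ℝ ∞ (chartRep i θ) y) :
    IsSmooth θ := fun i y hy => (h i y hy).contDiffWithinAt

theorem contMDiff_of_locallyConst {f : M → ℝ} (h : ∀ x, ∀ᶠ z in 𝓝 x, f z = f x) :
    ContMDiff (𝓡 d) 𝓘(ℝ, ℝ) ∞ f := fun x => contMDiffAt_const.congr_of_eventuallyEq (h x)

theorem IsSmooth.add {k : ℕ} {θ θ' : DForm d M k} (hθ : IsSmooth θ) (hθ' : IsSmooth θ') :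
    IsSmooth (θ + θ') :=
  isSmooth_of_contDiffAt fun _ _ hy => (hθ.contDiffAt hy).add (hθ'.contDiffAt hy)

theorem isSmooth_zero {k : ℕ} : IsSmooth (0 : DForm d M k) :=
  isSmooth_of_contDiffAt fun i y _ => by
    have : chartRep i (0 : DForm d M k) = fun _ => 0 := rfl
    rw [this]
    exact contDiffAt_const

theorem IsSmooth.wedgeForm {k l : ℕ} (h : k + l = d) {α : DForm d M k} {β : DForm d M l}
    (hα : IsSmooth α) (hβ : IsSmooth β) : IsSmooth (TwistedHodge.wedgeForm h α β) :=
  isSmooth_of_contDiffAt fun i y hy => by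
    refine contDiffAt_alternating fun j => ?_
    have : (fun z => chartRep i (TwistedHodge.wedgeForm h α β) z fun a => stdBasis d (j a)) =
        fun z => ((k.factorial * l.factorial : ℕ) : ℝ)⁻¹ *
          ∑ r : Fin k → Fin d, ∑ s : Fin l → Fin d, permSign (cat h r s) *
            (chartRep i α z (fun a => stdBasis d (j (r a))) *
              chartRep i β z (fun a => stdBasis d (j (s a)))) := by
      funext z
      rw [chartRep_wedgeForm, wedge_basis]
    rw [this]
    exact contDiffAt_const.mul (ContDiffAt.sum fun r _ => ContDiffAt.sum fun s _ =>
      contDiffAt_const.mul ((contDiffAt_alternating_apply (hα.contDiffAt hy) _).mul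
        (contDiffAt_alternating_apply (hβ.contDiffAt hy) _)))

/-- Forms of degree above the dimension vanish. -/
theorem eq_zero_of_lt {k : ℕ} (h : d < k) (θ : DForm d M k) : θ = 0 := by
  funext x
  refine ext_basis (tangentBasis x) fun i => ?_
  have hi : ¬ Function.Injective i := fun hi =>
    h.not_ge (by simpa using Fintype.card_le_of_injective i hi)
  exact (θ x).toAlternatingMap.map_eq_zero_of_not_injective _ fun hi' =>
    hi fun a b hab => hi' (congrArg (tangentBasis x) hab)

theorem contMDiff_exp {f : M → ℝ} (hf : ContMDiff (𝓡 d) 𝓘(ℝ, ℝ) ∞ f) :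
    ContMDiff (𝓡 d) 𝓘(ℝ, ℝ) ∞ fun x => Real.exp (f x) :=
  Real.contDiff_exp.contMDiff.comp hf

theorem contMDiff_const_mul {f : M → ℝ} (hf : ContMDiff (𝓡 d) 𝓘(ℝ, ℝ) ∞ f) (c : ℝ) :
    ContMDiff (𝓡 d) 𝓘(ℝ, ℝ) ∞ fun x => c * f x :=
  (contDiff_const.mul contDiff_id : ContDiff ℝ ∞ fun t : ℝ => c * t).contMDiff.comp hf

theorem contMDiff_exp_mul {lam : M → ℝ} (w : ℝ)
    (hlam : ContMDiff (𝓡 d) 𝓘(ℝ, ℝ) ∞ lam) :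
    ContMDiff (𝓡 d) 𝓘(ℝ, ℝ) ∞ fun x => Real.exp (w * lam x) :=
  contMDiff_exp (contMDiff_const_mul hlam w)

theorem contMDiff_exp_neg_mul {lam : M → ℝ} (w : ℝ)
    (hlam : ContMDiff (𝓡 d) 𝓘(ℝ, ℝ) ∞ lam) :
    ContMDiff (𝓡 d) 𝓘(ℝ, ℝ) ∞ fun x => Real.exp (-(w * lam x)) := by
  simpa only [neg_mul] using contMDiff_exp_mul (-w) hlam

variable [IsManifold (𝓡 d) ∞ M]

theorem contDiffAt_comp_chart_symm {f : M → ℝ} (hf : ContMDiff (𝓡 d) 𝓘(ℝ, ℝ) ∞ f) (i : M)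
    {y : E d} (hy : y ∈ (extChartAt (𝓡 d) i).target) :
    ContDiffAt ℝ ∞ (fun z => f ((extChartAt (𝓡 d) i).symm z)) y := by
  have hψ : ContMDiffAt 𝓘(ℝ, E d) (𝓡 d) ∞ (extChartAt (𝓡 d) i).symm y :=
    (contMDiffOn_extChartAt_symm i).contMDiffAt ((isOpen_extChartAt_target i).mem_nhds hy)
  exact ((hf _).comp y hψ).contDiffAt

theorem IsSmooth.mulForm {k : ℕ} {f : M → ℝ} (hf : ContMDiff (𝓡 d) 𝓘(ℝ, ℝ) ∞ f)
    {θ : DForm d M k} (hθ : IsSmooth θ) : IsSmooth (TwistedHodge.mulForm f θ) :=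
  isSmooth_of_contDiffAt fun i _ hy =>
    (contDiffAt_comp_chart_symm hf i hy).smul (hθ.contDiffAt hy)

theorem IsSmooth.extD {k : ℕ} {θ : DForm d M k} (hθ : IsSmooth θ) :
    IsSmooth (TwistedHodge.extD θ) :=
  isSmooth_of_contDiffAt fun i y hy => by
    refine (contDiffAt_extDeriv (hθ.contDiffAt hy)).congr_of_eventuallyEq ?_
    filter_upwards [(isOpen_extChartAt_target i).mem_nhds hy] with z hz
    exact chartRep_extD hθ hz

theorem eq_of_chartRep_eq {k : ℕ} {θ θ' : DForm d M k} {x : M}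
    (h : chartRep x θ (extChartAt (𝓡 d) x x) = chartRep x θ' (extChartAt (𝓡 d) x x)) :
    θ x = θ' x := by
  rw [← formAt_eq, ← formAt_eq] at h
  exact h

theorem extD_add {k : ℕ} {θ θ' : DForm d M k} (hθ : IsSmooth θ) (hθ' : IsSmooth θ') :
    extD (θ + θ') = extD θ + extD θ' := by
  funext x
  have hx := mem_extChartAt_target (I := 𝓡 d) x
  refine eq_of_chartRep_eq ?_
  rw [chartRep_extD (hθ.add hθ') hx, chartRep_add, chartRep_extD hθ hx, chartRep_extD hθ' hx]
  exact extDeriv_add ((hθ.contDiffAt hx).differentiableAt (by simp))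
    ((hθ'.contDiffAt hx).differentiableAt (by simp))

theorem extD_extD {k : ℕ} {θ : DForm d M k} (hθ : IsSmooth θ) : extD (extD θ) = 0 := by
  funext x
  have hx := mem_extChartAt_target (I := 𝓡 d) x
  refine eq_of_chartRep_eq (θ' := (0 : DForm d M (k + 2))) ?_
  rw [chartRep_extD hθ.extD hx]
  have : chartRep x (extD θ) =ᶠ[𝓝 (extChartAt (𝓡 d) x x)] extDeriv (chartRep x θ) := by
    filter_upwards [(isOpen_extChartAt_target x).mem_nhds hx] with z hz
    exact chartRep_extD hθ hz
  rw [this.extDeriv_eq,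
    extDeriv_extDeriv_apply (r := 2) ((hθ.contDiffAt hx).of_le two_le_infty) (by simp)]
  rfl

end FormOperations

/-! ### The codifferential -/

section Codifferential

variable {d : ℕ} {M : Type*} [TopologicalSpace M] [ChartedSpace (E d) M]
  [IsManifold (𝓡 d) ∞ M] (g : PseudoRiemannianMetric d M) (o : ManifoldOrientation d M)

theorem metricSign_mul_self (x : M) : metricSign g x * metricSign g x = 1 := by
  have := gram_det_ne_zero (g.val x) (g.nondegenerate x) (tangentBasis x)
  rw [metricSign]
  rcases this.lt_or_gt with h | h
  · simp [sign_neg h]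
  · simp [sign_pos h]

theorem metricSign_eventuallyEq (x : M) : ∀ᶠ z in 𝓝 x, metricSign g z = metricSign g x := by
  have hx := mem_extChartAt_target (I := 𝓡 d) x
  have h := (continuousAt_extChartAt (I := 𝓡 d) x).eventually
    (eventuallyEq_sign (contDiffAt_det (contDiffAt_chartGram g x hx)).continuousAt
      (chartGram_det_ne_zero g x hx))
  filter_upwards [h, extChartAt_source_mem_nhds (I := 𝓡 d) x] with z hz hzs
  rw [← metricSign_eq g x hx, ← metricSign_eq g x ((extChartAt (𝓡 d) x).map_source hzs),
    (extChartAt (𝓡 d) x).left_inv hzs, extChartAt_to_inv] at hz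
  exact hz

theorem hodgeStar_mulForm {k l : ℕ} (h : k + l = d) (f : M → ℝ) (θ : DForm d M k) :
    hodgeStar g o h (mulForm f θ) = mulForm f (hodgeStar g o h θ) :=
  funext fun x => star_smul h (g.val x) (o.orient x) (tangentBasis x) (f x) (θ x)

theorem hodgeStar_apply_eq_zero {k l : ℕ} (h : k + l = d) {θ : DForm d M k} {x : M}
    (hx : θ x = 0) : hodgeStar g o h θ x = 0 := by
  rw [hodgeStar, hx, star_zero]

theorem hodgeStar_hodgeStar {k l : ℕ} (h₁ : l + k = d) (h₂ : k + l = d) (μ : DForm d M l) :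
    hodgeStar g o h₂ (hodgeStar g o h₁ μ) =
      mulForm (fun x => (-1) ^ (k * l) * metricSign g x) μ :=
  funext fun x => star_star (g.val x) (g.symm x) (g.nondegenerate x) h₁ h₂ (o.orient x)
    (tangentBasis x) (μ x)

theorem hodgeStar_injective {k l : ℕ} (h : k + l = d) {θ θ' : DForm d M k}
    (hθ : hodgeStar g o h θ = hodgeStar g o h θ') : θ = θ' := by
  have h' : l + k = d := by omega
  have h1 := congrArg (hodgeStar g o h') hθ
  rw [hodgeStar_hodgeStar, hodgeStar_hodgeStar] at h1
  funext x
  have h2 : (-1 : ℝ) ^ (l * k) * metricSign g x ≠ 0 :=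
    mul_ne_zero (pow_ne_zero _ (by norm_num))
      (left_ne_zero_of_mul (by rw [metricSign_mul_self]; norm_num))
  exact smul_right_injective _ h2 (congrFun h1 x)

/-- The sign in front of `* d *` in the codifferential of `(p + 1)`-forms. -/
def codiffSign (p : ℕ) (x : M) : ℝ := (-1 : ℝ) ^ (d * (p + 2) + 1) * metricSign g x

theorem codiffSign_eventuallyEq (p : ℕ) (x : M) :
    ∀ᶠ z in 𝓝 x, codiffSign g p z = codiffSign g p x :=
  (metricSign_eventuallyEq g x).mono fun z hz => by rw [codiffSign, codiffSign, hz]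

theorem codiff_of_le {p : ℕ} (h : p + 1 ≤ d) (ξ : DForm d M (p + 1)) :
    codiff g o ξ = mulForm (codiffSign g p)
      (hodgeStar g o (k := d - (p + 1) + 1) (l := p) (by omega)
        (extD (hodgeStar g o (k := p + 1) (l := d - (p + 1)) (by omega) ξ))) := by
  rw [codiff, dif_pos h]
  rfl

theorem codiff_of_not_le {p : ℕ} (h : ¬ p + 1 ≤ d) (ξ : DForm d M (p + 1)) :
    codiff g o ξ = 0 := by
  rw [codiff, dif_neg h]

theorem IsSmooth.codiff {p : ℕ} {ξ : DForm d M (p + 1)} (hξ : IsSmooth ξ) :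
    IsSmooth (TwistedHodge.codiff g o ξ) := by
  by_cases h : p + 1 ≤ d
  · rw [codiff_of_le g o h]
    exact ((hξ.hodgeStar g o _).extD.hodgeStar g o _).mulForm
      (contMDiff_of_locallyConst (codiffSign_eventuallyEq g p))
  · rw [codiff_of_not_le g o h]
    exact isSmooth_zero

theorem codiff_eq_zero_of_eventually {p : ℕ} {ξ : DForm d M (p + 1)} {x : M}
    (hx : ∀ᶠ z in 𝓝 x, ξ z = 0) : TwistedHodge.codiff g o ξ x = 0 := by
  by_cases h : p + 1 ≤ d
  · rw [codiff_of_le g o h]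
    have h1 : extD (hodgeStar g o (k := p + 1) (l := d - (p + 1)) (by omega) ξ) x = 0 := by
      rw [extD_congr (θ' := 0) (hx.mono fun z hz => hodgeStar_apply_eq_zero g o _ hz), extD_zero]
      rfl
    rw [mulForm, hodgeStar_apply_eq_zero g o _ h1, smul_zero]
  · rw [codiff_of_not_le g o h]
    rfl

/-- As `**` is locally constant, `d * (f * μ) = ± f dμ` for locally constant `f`; in particular it
vanishes if `μ` is closed. With `μ = d * ξ` this is the reason for `δδ = 0`. -/
theorem extD_hodgeStar_hodgeStar {k l q : ℕ} (h₁ : q + k = d) (h₂ : k + l = d) {f : M → ℝ}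
    (hf : ∀ x, ∀ᶠ z in 𝓝 x, f z = f x) {μ : DForm d M q} (hμ : extD μ = 0) :
    extD (hodgeStar g o h₂ (mulForm f (hodgeStar g o h₁ μ))) = 0 := by
  obtain rfl : q = l := by omega
  funext x
  rw [hodgeStar_mulForm, hodgeStar_hodgeStar, mulForm_mulForm, extD_mulForm, hμ]
  · exact smul_zero _
  · filter_upwards [hf x, metricSign_eventuallyEq g x] with z h1 h2
    rw [h1, h2]

theorem codiff_codiff {p : ℕ} {ξ : DForm d M (p + 2)} (hξ : IsSmooth ξ) :
    codiff g o (codiff g o ξ) = 0 := by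
  by_cases h : p + 2 ≤ d
  · rw [codiff_of_le g o (p := p + 1) h, codiff_of_le g o (p := p) (by omega),
      extD_hodgeStar_hodgeStar g o _ _ (codiffSign_eventuallyEq g (p + 1))
        (extD_extD (hξ.hodgeStar g o _))]
    funext x
    rw [mulForm, hodgeStar_apply_eq_zero g o _ rfl, smul_zero]
    rfl
  · rw [codiff_of_not_le g o (p := p + 1) h]
    by_cases h' : p + 1 ≤ d
    · funext x
      exact codiff_eq_zero_of_eventually g o (Filter.Eventually.of_forall fun _ => rfl)
    · exact codiff_of_not_le g o h' _

theorem wedge_hodgeStar_hodgeStar {k l q : ℕ} (h₁ : q + k = d) (h₂ : k + l = d) (h₃ : k + q = d)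
    (α : DForm d M k) (μ : DForm d M q) :
    wedgeForm h₂ α (hodgeStar g o h₂ (hodgeStar g o h₁ μ)) =
      mulForm (fun x => (-1) ^ (k * l) * metricSign g x) (wedgeForm h₃ α μ) := by
  obtain rfl : q = l := by omega
  rw [hodgeStar_hodgeStar]
  exact funext fun x => wedge_smul_right _ _ _ _

/-- The sign `(-1)^(d(p+2)+1)` in `δ` and the sign `(-1)^(p(d-p))` in `**` combine to
`(-1)^(p+1)`. -/
theorem neg_one_pow_codiff {p : ℕ} (h : p + 1 ≤ d) :
    (-1 : ℝ) ^ (d * (p + 2) + 1) * (-1) ^ (p * (d - p)) = (-1) ^ (p + 1) := by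
  obtain ⟨m, rfl⟩ := Nat.exists_eq_add_of_le (show p ≤ d by omega)
  rw [← pow_add, Nat.add_sub_cancel_left,
    show (p + m) * (p + 2) + 1 + p * m = (p * (p + 1)) + 2 * (p * m + m) + (p + 1) by ring,
    pow_add, pow_add, pow_mul _ 2, neg_one_sq, one_pow, mul_one,
    (Nat.even_mul_succ_self p).neg_one_pow, one_mul]

/-- The algebra behind the adjointness: `η ∧ *δξ = (-1)^(p+1) η ∧ d*ξ`. -/
theorem wedge_hodgeStar_codiff {p : ℕ} (h : p + 1 ≤ d) (η : DForm d M p) (ξ : DForm d M (p + 1)) :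
    wedgeForm (k := p) (l := d - p) (n := d) (by omega) η
        (hodgeStar g o (k := p) (l := d - p) (by omega) (codiff g o ξ)) =
      mulForm (fun _ => (-1) ^ (p + 1)) (wedgeForm (k := p) (l := d - (p + 1) + 1) (n := d)
        (by omega) η (extD (hodgeStar g o (k := p + 1) (l := d - (p + 1)) (by omega) ξ))) := by
  rw [codiff_of_le g o h, hodgeStar_mulForm]
  rw [wedgeForm_mulForm_right, wedge_hodgeStar_hodgeStar g o _ _
    (show p + (d - (p + 1) + 1) = d by omega),
    mulForm_mulForm]
  congr 1
  funext x
  rw [codiffSign, ← neg_one_pow_codiff h]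
  linear_combination ((-1 : ℝ) ^ (d * (p + 2) + 1) * (-1) ^ (p * (d - p))) * metricSign_mul_self g x

end Codifferential

/-! ### Integration of compactly supported top-degree forms -/

section Integration

variable {d : ℕ} {M : Type*} [TopologicalSpace M] [ChartedSpace (E d) M]
  (o : ManifoldOrientation d M)

/-- The density of a `d`-form in the chart at `i`: its coefficient in the coordinates of the chart,
with the sign of the coordinate frame. -/
def chartDensity (i : M) (θ : DForm d M d) (y : E d) : ℝ :=
  chartSign o i y * chartRep i θ y (stdBasis d)

theorem chartDensity_eq_zero {θ : DForm d M d} {i : M} {y : E d}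
    (h : θ ((extChartAt (𝓡 d) i).symm y) = 0) : chartDensity o i θ y = 0 := by
  have : chartRep i θ y = 0 := by
    rw [chartRep_eq, show formAt θ ((extChartAt (𝓡 d) i).symm y) = 0 from h]
    rfl
  rw [chartDensity, this]
  exact mul_zero _

/-- A continuous function on the target of a chart is integrable if it vanishes off a compact part
of the chart domain. -/
theorem integrableOn_target {F : E d → ℝ} {i : M} {C : Set M} (hC : IsCompact C)
    (hCi : C ⊆ (extChartAt (𝓡 d) i).source) (hF : ContinuousOn F (extChartAt (𝓡 d) i).target)
    (h0 : ∀ y ∈ (extChartAt (𝓡 d) i).target, (extChartAt (𝓡 d) i).symm y ∉ C → F y = 0) :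
    IntegrableOn F (extChartAt (𝓡 d) i).target := by
  have hK : IsCompact (extChartAt (𝓡 d) i '' C) :=
    hC.image_of_continuousOn ((continuousOn_extChartAt i).mono hCi)
  have hsub : extChartAt (𝓡 d) i '' C ⊆ (extChartAt (𝓡 d) i).target :=
    image_subset_iff.mpr fun x hx => (extChartAt (𝓡 d) i).map_source (hCi hx)
  refine IntegrableOn.of_forall_sdiff_eq_zero ((hF.mono hsub).integrableOn_compact hK)
    (isOpen_extChartAt_target i).measurableSet fun y hy => h0 y hy.1 fun h => hy.2 ?_
  exact ⟨_, h, (extChartAt (𝓡 d) i).right_inv hy.1⟩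

theorem image_transition (i j : M) : transition i j '' overlap d i j = overlap d j i := by
  refine Subset.antisymm (image_subset_iff.mpr fun y hy => transition_mem_overlap hy) fun y hy => ?_
  exact ⟨transition j i y, transition_mem_overlap hy, transition_transition hy⟩

variable [IsManifold (𝓡 d) ∞ M]

theorem compContinuousLinearMap_stdBasis (A : E d [⋀^Fin d]→L[ℝ] ℝ) (f : E d →L[ℝ] E d) :
    A.compContinuousLinearMap f (stdBasis d) = f.det * A (stdBasis d) := by
  have h := AlternatingMap.eq_smul_basis_det (stdBasis d) A.toAlternatingMap
  have h1 := congrArg (fun θ => θ (f ∘ stdBasis d)) h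
  have h2 := (stdBasis d).det_comp (f : E d →ₗ[ℝ] E d) (stdBasis d)
  rw [Module.Basis.det_self, mul_one] at h2
  simp only [AlternatingMap.smul_apply, smul_eq_mul] at h1
  rw [mul_comm]
  refine Eq.trans ?_ (h1.trans (congrArg _ h2))
  rfl

/-- The sign of the coordinate frame changes by the sign of the Jacobian of the transition map. -/
theorem chartSign_transition {i j : M} {y : E d} (hy : y ∈ overlap d i j) :
    chartSign o i y =
      (SignType.sign (fderiv ℝ (transition i j) y).det : ℝ) * chartSign o j (transition i j y) := by
  -- the sign of a frame is the sign of a (not necessarily smooth) form evaluated on it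
  have h : ∀ (m : M) (z : E d), chartSign o m z = (SignType.sign
      (chartRep m (fun x => toCont (o.orient x).someVector) z (stdBasis d)) : ℝ) :=
    fun _ _ => rfl
  rw [h, h, chartRep_transition _ hy, compContinuousLinearMap_stdBasis, sign_mul, SignType.coe_mul]

/-- Densities transform by the absolute value of the Jacobian. -/
theorem chartDensity_transition (θ : DForm d M d) {i j : M} {y : E d} (hy : y ∈ overlap d i j) :
    chartDensity o i θ y =
      |(fderiv ℝ (transition i j) y).det| * chartDensity o j θ (transition i j y) := by
  rw [chartDensity, chartDensity, chartSign_transition o hy, chartRep_transition θ hy,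
    compContinuousLinearMap_stdBasis, ← sign_mul_self]
  ring

/-- Change of variables between two charts. -/
theorem setIntegral_overlap (f : M → ℝ) (θ : DForm d M d) (i j : M) :
    ∫ y in overlap d i j, f ((extChartAt (𝓡 d) i).symm y) * chartDensity o i θ y =
      ∫ y in overlap d j i, f ((extChartAt (𝓡 d) j).symm y) * chartDensity o j θ y := by
  have hinj : InjOn (transition i j) (overlap d i j) := fun y hy z hz h => by
    rw [← transition_transition hy, h, transition_transition hz]
  have := integral_image_eq_integral_abs_det_fderiv_smul volume (isOpen_overlap i j).measurableSet
    (fun y hy =>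
      ((contDiffAt_transition hy).differentiableAt (by simp)).hasFDerivAt.hasFDerivWithinAt)
    hinj (fun y => f ((extChartAt (𝓡 d) j).symm y) * chartDensity o j θ y)
  rw [image_transition] at this
  rw [this]
  refine setIntegral_congr_fun (isOpen_overlap i j).measurableSet fun y hy => ?_
  simp only [chartDensity_transition o θ hy, symm_transition hy, smul_eq_mul]
  ring

/-- Two charts give the same integral to a form cut off to the intersection of their domains. -/
theorem setIntegral_target_eq {f : M → ℝ} {θ : DForm d M d} {i j : M}
    (hf : ∀ x, f x ≠ 0 → x ∈ (extChartAt (𝓡 d) i).source)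
    (hθ : ∀ x, θ x ≠ 0 → x ∈ (extChartAt (𝓡 d) j).source) :
    ∫ y in (extChartAt (𝓡 d) i).target,
        f ((extChartAt (𝓡 d) i).symm y) * chartDensity o i θ y =
      ∫ y in (extChartAt (𝓡 d) j).target,
        f ((extChartAt (𝓡 d) j).symm y) * chartDensity o j θ y := by
  refine (setIntegral_eq_of_subset_of_forall_sdiff_eq_zero (s := overlap d i j)
    (isOpen_extChartAt_target i).measurableSet inter_subset_left ?_).trans
      ((setIntegral_overlap o f θ i j).trans
        (setIntegral_eq_of_subset_of_forall_sdiff_eq_zero (s := overlap d j i)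
          (isOpen_extChartAt_target j).measurableSet inter_subset_left ?_).symm)
  · rintro y ⟨hy, hn⟩
    rw [chartDensity_eq_zero o, mul_zero]
    by_contra h
    exact hn ⟨hy, hθ _ h⟩
  · rintro y ⟨hy, hn⟩
    have : f ((extChartAt (𝓡 d) j).symm y) = 0 := by
      by_contra h
      exact hn ⟨hy, hf _ h⟩
    rw [this, zero_mul]

theorem contDiffAt_chartDensity {θ : DForm d M d} (hθ : IsSmooth θ) {i : M} {y : E d}
    (hy : y ∈ (extChartAt (𝓡 d) i).target) : ContDiffAt ℝ ∞ (chartDensity o i θ) y :=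
  (contDiffAt_chartSign o i hy).mul (contDiffAt_alternating_apply (hθ.contDiffAt hy) _)

theorem integrableOn_chartDensity {f : M → ℝ} (hf : ContMDiff (𝓡 d) 𝓘(ℝ, ℝ) ∞ f) {θ : DForm d M d}
    (hθ : IsSmooth θ) {i : M} {C : Set M} (hC : IsCompact C)
    (hCi : C ⊆ (extChartAt (𝓡 d) i).source) (h0 : ∀ x, f x ≠ 0 → θ x ≠ 0 → x ∈ C) :
    IntegrableOn (fun y => f ((extChartAt (𝓡 d) i).symm y) * chartDensity o i θ y)
      (extChartAt (𝓡 d) i).target := by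
  refine integrableOn_target hC hCi (fun y hy => ?_) fun y hy hn => ?_
  · exact ((contDiffAt_comp_chart_symm hf i hy).mul
      (contDiffAt_chartDensity o hθ hy)).continuousAt.continuousWithinAt
  · by_contra h
    refine hn (h0 _ (left_ne_zero_of_mul h) fun hθ0 => ?_)
    exact right_ne_zero_of_mul h (chartDensity_eq_zero o hθ0)

variable [T2Space M] [SigmaCompactSpace M]

theorem chartPartition_subset (i : M) :
    tsupport (chartPartition d M i) ⊆ (extChartAt (𝓡 d) i).source := by
  rw [extChartAt_source]
  exact (SmoothPartitionOfUnity.exists_isSubordinate_chartAt_source (𝓡 d) M).choose_spec i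

theorem integralForm_eq (θ : DForm d M d) :
    integralForm o θ = ∑ᶠ i : M, ∫ y in (extChartAt (𝓡 d) i).target,
      chartPartition d M i ((extChartAt (𝓡 d) i).symm y) * chartDensity o i θ y := rfl

/-- A compact set meets only finitely many of the supports of the partition of unity. -/
theorem finite_tsupport_chartPartition_inter (d : ℕ) {M : Type*} [TopologicalSpace M]
    [ChartedSpace (E d) M] [IsManifold (𝓡 d) ∞ M] [T2Space M] [SigmaCompactSpace M]
    {K : Set M} (hK : IsCompact K) :
    {i : M | (tsupport (chartPartition d M i) ∩ K).Nonempty}.Finite :=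
  (chartPartition d M).locallyFinite.closure.finite_nonempty_inter_compact hK

/-- Only the charts whose cut-off function meets the support of `θ` contribute to the integral. -/
theorem support_integralForm (θ : DForm d M d) :
    (Function.support fun i : M => ∫ y in (extChartAt (𝓡 d) i).target,
      chartPartition d M i ((extChartAt (𝓡 d) i).symm y) * chartDensity o i θ y) ⊆
        {i | (tsupport (chartPartition d M i) ∩ closure {x | θ x ≠ 0}).Nonempty} := by
  intro i hi
  by_contra hn
  refine hi (setIntegral_eq_zero_of_forall_eq_zero fun y _ => ?_)
  by_contra h
  refine hn ⟨_, subset_closure (left_ne_zero_of_mul h), subset_closure fun h0 => ?_⟩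
  exact right_ne_zero_of_mul h (chartDensity_eq_zero o h0)

theorem integrableOn_chartPartition {θ : DForm d M d} (hθ : IsSmooth θ)
    (hc : IsCompactlySupported θ) (i : M) :
    IntegrableOn (fun y => chartPartition d M i ((extChartAt (𝓡 d) i).symm y) *
      chartDensity o i θ y) (extChartAt (𝓡 d) i).target :=
  integrableOn_chartDensity o ((chartPartition d M i).contMDiff) hθ
    (hc.inter_right (isClosed_tsupport (chartPartition d M i)))
    (inter_subset_right.trans (chartPartition_subset i))
    fun _ h1 h2 => ⟨subset_closure h2, subset_closure h1⟩

theorem integralForm_add {θ θ' : DForm d M d} (hθ : IsSmooth θ) (hc : IsCompactlySupported θ)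
    (hθ' : IsSmooth θ') (hc' : IsCompactlySupported θ') :
    integralForm o (θ + θ') = integralForm o θ + integralForm o θ' := by
  simp only [integralForm_eq]
  rw [← finsum_add_distrib
    ((finite_tsupport_chartPartition_inter d hc).subset (support_integralForm o θ))
    ((finite_tsupport_chartPartition_inter d hc').subset (support_integralForm o θ'))]
  refine finsum_congr fun i => ?_
  rw [← integral_add (integrableOn_chartPartition o hθ hc i)
    (integrableOn_chartPartition o hθ' hc' i)]
  refine integral_congr_ae (Filter.Eventually.of_forall fun y => ?_)
  simp only [chartDensity, chartRep_add, ContinuousAlternatingMap.add_apply]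
  ring

theorem integralForm_const_mul (c : ℝ) (θ : DForm d M d) :
    integralForm o (mulForm (fun _ => c) θ) = c * integralForm o θ := by
  simp only [integralForm_eq]
  rw [← smul_eq_mul, smul_finsum]
  refine finsum_congr fun i => ?_
  rw [smul_eq_mul, ← integral_const_mul]
  refine integral_congr_ae (Filter.Eventually.of_forall fun y => ?_)
  simp only [chartDensity, chartRep_mulForm, ContinuousAlternatingMap.smul_apply, smul_eq_mul]
  ring

/-- The integral of a form supported in the domain of a chart is computed in that chart. -/
theorem integralForm_eq_setIntegral {θ : DForm d M d} (hθ : IsSmooth θ)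
    (hc : IsCompactlySupported θ) {m : M}
    (hm : closure {x | θ x ≠ 0} ⊆ (extChartAt (𝓡 d) m).source) :
    integralForm o θ = ∫ y in (extChartAt (𝓡 d) m).target, chartDensity o m θ y := by
  have hfin := finite_tsupport_chartPartition_inter d hc
  rw [integralForm_eq, finsum_eq_sum_of_support_subset _ (s := hfin.toFinset)
    (by simpa using support_integralForm o θ)]
  have h1 : ∀ i, ∫ y in (extChartAt (𝓡 d) i).target,
      chartPartition d M i ((extChartAt (𝓡 d) i).symm y) * chartDensity o i θ y =
      ∫ y in (extChartAt (𝓡 d) m).target,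
        chartPartition d M i ((extChartAt (𝓡 d) m).symm y) * chartDensity o m θ y := fun i =>
    setIntegral_target_eq o (fun x hx => chartPartition_subset i (subset_closure hx))
      fun x hx => hm (subset_closure hx)
  simp only [h1]
  rw [← integral_finsetSum _ fun i _ => integrableOn_chartDensity o
    ((chartPartition d M i).contMDiff) hθ hc hm fun x _ hx => subset_closure hx]
  refine integral_congr_ae (Filter.Eventually.of_forall fun y => ?_)
  simp only
  rw [← Finset.sum_mul]
  by_cases hy : θ ((extChartAt (𝓡 d) m).symm y) = 0
  · rw [chartDensity_eq_zero o hy, mul_zero]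
  · rw [← finsum_eq_sum_of_support_subset, (chartPartition d M).sum_eq_one (mem_univ _), one_mul]
    intro i hi
    rw [Finite.coe_toFinset]
    exact ⟨_, subset_closure hi, subset_closure hy⟩

end Integration

/-! ### The Leibniz rule and Stokes' theorem -/

section LeibnizAlgebra

variable {d : ℕ}

/-- If `G` is antisymmetric in moving an index to the front, the `p + 1` terms of an alternating sum
contracted with `G` all agree. -/
theorem sum_alternating {X : Type*} [Fintype X] {p : ℕ} (G : (Fin (p + 1) → X) → ℝ)
    (hG : ∀ (a : Fin (p + 1)) (t : X) (i : Fin p → X),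
      G (a.insertNth t i) = (-1) ^ (a : ℕ) * G (Fin.cons t i)) (D : X → (Fin p → X) → ℝ) :
    ∑ I, G I * ∑ a : Fin (p + 1), (-1) ^ (a : ℕ) * D (I a) (a.removeNth I) =
      (p + 1) * ∑ t, ∑ i, G (Fin.cons t i) * D t i := by
  simp only [Finset.mul_sum]
  rw [Finset.sum_comm]
  have h : ∀ a : Fin (p + 1), ∑ I : Fin (p + 1) → X, G I * ((-1) ^ (a : ℕ) *
      D (I a) (a.removeNth I)) = ∑ t, ∑ i, G (Fin.cons t i) * D t i := fun a => by
    rw [← (Fin.insertNthEquiv (fun _ => X) a).sum_comp, Fintype.sum_prod_type]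
    refine Finset.sum_congr rfl fun t _ => Finset.sum_congr rfl fun i _ => ?_
    change G (a.insertNth t i) * ((-1) ^ (a : ℕ) * D ((a.insertNth t i : Fin (p + 1) → X) a)
      (a.removeNth (a.insertNth t i : Fin (p + 1) → X))) = _
    rw [Fin.insertNth_apply_same, Fin.removeNth_insertNth, hG]
    have : (-1 : ℝ) ^ (a : ℕ) * (-1) ^ (a : ℕ) = 1 := by
      rw [← mul_pow]; norm_num
    linear_combination (G (Fin.cons t i) * D t i) * this
  rw [Finset.sum_congr rfl fun a _ => h a]
  simp [Finset.mul_sum]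

theorem comp_insertNth {X Y : Type*} (f : X → Y) {n : ℕ} (a : Fin (n + 1)) (t : X)
    (i : Fin n → X) :
    (fun m => f ((a.insertNth t i : Fin (n + 1) → X) m)) = a.insertNth (f t) fun m => f (i m) := by
  rw [Fin.eq_insertNth_iff]
  refine ⟨by rw [Fin.insertNth_apply_same], ?_⟩
  funext m
  simp [Fin.removeNth]

theorem comp_cons {X Y : Type*} (f : X → Y) {n : ℕ} (t : X) (i : Fin n → X) :
    (fun m => f ((Fin.cons t i : Fin (n + 1) → X) m)) = Fin.cons (f t) fun m => f (i m) := by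
  funext m
  refine Fin.cases rfl (fun m => rfl) m

theorem permSign_cat_insertNth_right {k l : ℕ} (h : k + (l + 1) = d) (i : Fin k → Fin d)
    (a : Fin (l + 1)) (t : Fin d) (j : Fin l → Fin d) :
    permSign (cat h i (a.insertNth t j)) = (-1) ^ (a : ℕ) * permSign (cat h i (Fin.cons t j)) := by
  have := (insertFirst h (V := Fin d → ℝ) (Pi.basisFun ℝ (Fin d)).det
    (fun m => Pi.basisFun ℝ (Fin d) (i m))).map_insertNth a (Pi.basisFun ℝ (Fin d) t)
      (fun m => Pi.basisFun ℝ (Fin d) (j m))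
  rw [← comp_insertNth (Pi.basisFun ℝ (Fin d)), Matrix.vecCons,
    ← comp_cons (Pi.basisFun ℝ (Fin d))] at this
  simpa only [permSign, comp_cat (Pi.basisFun ℝ (Fin d)), insertFirst_apply, zsmul_eq_mul,
    Int.cast_pow, Int.cast_neg, Int.cast_one] using this

theorem permSign_cat_insertNth_left {k l : ℕ} (h : k + 1 + l = d) (a : Fin (k + 1)) (t : Fin d)
    (i : Fin k → Fin d) (j : Fin l → Fin d) :
    permSign (cat h (a.insertNth t i) j) = (-1) ^ (a : ℕ) * permSign (cat h (Fin.cons t i) j) := by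
  have h' : l + (k + 1) = d := by omega
  rw [permSign_cat_swap h h', permSign_cat_insertNth_right, permSign_cat_swap h h' (Fin.cons t i)]
  ring

/-- An index may be moved from the front of the second block to the front of the first. -/
theorem permSign_cat_cons {k l : ℕ} (h₁ : k + 1 + l = d) (h₂ : k + (l + 1) = d) (t : Fin d)
    (i : Fin k → Fin d) (j : Fin l → Fin d) :
    permSign (cat h₂ i (Fin.cons t j)) = (-1) ^ k * permSign (cat h₁ (Fin.cons t i) j) := by
  obtain rfl : d = k + l + 1 := by omega
  rw [cat_cons_right h₂ rfl, cat_cons h₁ rfl]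
  have h := (Pi.basisFun ℝ (Fin (k + l + 1))).det.map_insertNth ⟨k, by omega⟩
    (Pi.basisFun ℝ (Fin (k + l + 1)) t) (fun m => Pi.basisFun ℝ (Fin (k + l + 1)) (cat rfl i j m))
  rw [← comp_insertNth (Pi.basisFun ℝ (Fin (k + l + 1))), Matrix.vecCons,
    ← comp_cons (Pi.basisFun ℝ (Fin (k + l + 1))), zsmul_eq_mul] at h
  push_cast at h
  exact h

variable {p l : ℕ} {α : E d → E d [⋀^Fin p]→L[ℝ] ℝ} {ν : E d → E d [⋀^Fin l]→L[ℝ] ℝ} {y : E d}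

theorem extDeriv_stdBasis (hα : DifferentiableAt ℝ α y) (I : Fin (p + 1) → Fin d) :
    extDeriv α y (fun m => stdBasis d (I m)) = ∑ a : Fin (p + 1), (-1) ^ (a : ℕ) *
      fderiv ℝ (fun z => α z fun m => stdBasis d ((a.removeNth I : Fin p → Fin d) m)) y
        (stdBasis d (I a)) := by
  rw [extDeriv_apply hα]
  refine Finset.sum_congr rfl fun a _ => ?_
  rw [zsmul_eq_mul]
  push_cast
  rfl

/-- The components of `dα ∧ β`. -/
theorem wedge_extDeriv_left (h : p + 1 + l = d) (hα : DifferentiableAt ℝ α y)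
    (β : E d [⋀^Fin l]→L[ℝ] ℝ) :
    wedge h (extDeriv α y) β (stdBasis d) = ((p.factorial * l.factorial : ℕ) : ℝ)⁻¹ *
      ∑ j : Fin l → Fin d, ∑ t, ∑ i : Fin p → Fin d, permSign (cat h (Fin.cons t i) j) *
        (fderiv ℝ (fun z => α z fun m => stdBasis d (i m)) y (stdBasis d t) *
          β fun m => stdBasis d (j m)) := by
  rw [wedge_basis, Finset.sum_comm, Finset.mul_sum, Finset.mul_sum]
  refine Finset.sum_congr rfl fun j _ => ?_
  have := sum_alternating (fun I : Fin (p + 1) → Fin d => permSign (cat h I j))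
    (fun a t i => permSign_cat_insertNth_left h a t i j)
    fun t i => fderiv ℝ (fun z => α z fun m => stdBasis d (i m)) y (stdBasis d t)
  simp only [extDeriv_stdBasis hα, ← mul_assoc, ← Finset.sum_mul]
  rw [this, Nat.factorial_succ]
  push_cast
  have h1 : (p : ℝ) + 1 ≠ 0 := by positivity
  have h2 : (p.factorial : ℝ) ≠ 0 := by positivity
  have h3 : (l.factorial : ℝ) ≠ 0 := by positivity
  field_simp

/-- The components of `β ∧ dν`, where the derivative has been moved past `β`. -/
theorem wedge_extDeriv_right (h₁ : p + 1 + l = d) (h₂ : p + (l + 1) = d)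
    (hν : DifferentiableAt ℝ ν y) (β : E d [⋀^Fin p]→L[ℝ] ℝ) :
    wedge h₂ β (extDeriv ν y) (stdBasis d) = (-1) ^ p * (((p.factorial * l.factorial : ℕ) : ℝ)⁻¹ *
      ∑ i : Fin p → Fin d, ∑ t, ∑ j : Fin l → Fin d, permSign (cat h₁ (Fin.cons t i) j) *
        ((β fun m => stdBasis d (i m)) *
          fderiv ℝ (fun z => ν z fun m => stdBasis d (j m)) y (stdBasis d t))) := by
  rw [wedge_basis, mul_left_comm, Finset.mul_sum, Finset.mul_sum, Finset.mul_sum]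
  refine Finset.sum_congr rfl fun i _ => ?_
  have := sum_alternating (fun J : Fin (l + 1) → Fin d => permSign (cat h₂ i J))
    (fun a t j => permSign_cat_insertNth_right h₂ i a t j)
    fun t j => fderiv ℝ (fun z => ν z fun m => stdBasis d (j m)) y (stdBasis d t)
  simp only [extDeriv_stdBasis hν, mul_left_comm _ (β _), ← Finset.mul_sum]
  simp only [permSign_cat_cons h₁ h₂, mul_assoc, ← Finset.mul_sum] at this
  rw [this, Nat.factorial_succ]
  push_cast
  have h1 : (l : ℝ) + 1 ≠ 0 := by positivity
  have h2 : (p.factorial : ℝ) ≠ 0 := by positivity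
  have h3 : (l.factorial : ℝ) ≠ 0 := by positivity
  field_simp

/-- The Leibniz rule for top-degree forms in coordinates: `dα ∧ ν + (-1)^p α ∧ dν` is a sum of
partial derivatives. -/
theorem leibniz_stdBasis (h₁ : p + 1 + l = d) (h₂ : p + (l + 1) = d)
    (hα : DifferentiableAt ℝ α y) (hν : DifferentiableAt ℝ ν y) :
    wedge h₁ (extDeriv α y) (ν y) (stdBasis d) +
        (-1) ^ p * wedge h₂ (α y) (extDeriv ν y) (stdBasis d) =
      ∑ t, fderiv ℝ (fun z => ((p.factorial * l.factorial : ℕ) : ℝ)⁻¹ *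
        ∑ i : Fin p → Fin d, ∑ j : Fin l → Fin d, permSign (cat h₁ (Fin.cons t i) j) *
          ((α z fun m => stdBasis d (i m)) * ν z fun m => stdBasis d (j m))) y (stdBasis d t) := by
  have hα' : ∀ i : Fin p → Fin d, DifferentiableAt ℝ (fun z => α z fun m => stdBasis d (i m)) y :=
    fun i => hα.continuousAlternatingMap_apply_const _
  have hν' : ∀ i : Fin l → Fin d, DifferentiableAt ℝ (fun z => ν z fun m => stdBasis d (i m)) y :=
    fun i => hν.continuousAlternatingMap_apply_const _
  have hd : ∀ t, fderiv ℝ (fun z => ((p.factorial * l.factorial : ℕ) : ℝ)⁻¹ *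
        ∑ i : Fin p → Fin d, ∑ j : Fin l → Fin d, permSign (cat h₁ (Fin.cons t i) j) *
          ((α z fun m => stdBasis d (i m)) * ν z fun m => stdBasis d (j m))) y (stdBasis d t) =
      ((p.factorial * l.factorial : ℕ) : ℝ)⁻¹ *
        ∑ i : Fin p → Fin d, ∑ j : Fin l → Fin d, permSign (cat h₁ (Fin.cons t i) j) *
          (fderiv ℝ (fun z => α z fun m => stdBasis d (i m)) y (stdBasis d t) *
            (ν y fun m => stdBasis d (j m)) + (α y fun m => stdBasis d (i m)) *
              fderiv ℝ (fun z => ν z fun m => stdBasis d (j m)) y (stdBasis d t)) := by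
    intro t
    have := ((HasFDerivAt.fun_sum (u := Finset.univ) fun (i : Fin p → Fin d) _ =>
      HasFDerivAt.fun_sum (u := Finset.univ) fun (j : Fin l → Fin d) _ =>
        (((hα' i).hasFDerivAt.mul (hν' j).hasFDerivAt).const_mul
          (permSign (cat h₁ (Fin.cons t i) j)))).const_mul
            ((p.factorial * l.factorial : ℕ) : ℝ)⁻¹).fderiv
    refine (congrArg (fun A : E d →L[ℝ] ℝ => A (stdBasis d t)) this).trans ?_
    simp only [smul_apply, sum_apply,
      add_apply, smul_eq_mul]
    refine congrArg _ (Finset.sum_congr rfl fun i _ => Finset.sum_congr rfl fun j _ => ?_)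
    ring
  have hs : (-1 : ℝ) ^ p * (-1) ^ p = 1 := by rw [← mul_pow]; norm_num
  rw [wedge_extDeriv_left h₁ hα, wedge_extDeriv_right h₁ h₂ hν, ← mul_assoc, hs, one_mul,
    ← mul_add, Finset.sum_congr rfl fun t _ => hd t, ← Finset.mul_sum]
  congr 1
  have e1 : ∀ F : (Fin l → Fin d) → Fin d → (Fin p → Fin d) → ℝ,
      ∑ j, ∑ t, ∑ i, F j t i = ∑ t, ∑ i, ∑ j, F j t i := fun F => by
    rw [Finset.sum_comm]
    exact Finset.sum_congr rfl fun t _ => Finset.sum_comm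
  rw [e1, Finset.sum_comm (f := fun (i : Fin p → Fin d) (t : Fin d) => ∑ j : Fin l → Fin d,
    permSign (cat h₁ (Fin.cons t i) j) * ((α y fun m => stdBasis d (i m)) *
      fderiv ℝ (fun z => ν z fun m => stdBasis d (j m)) y (stdBasis d t)))]
  simp only [← Finset.sum_add_distrib, ← mul_add]

end LeibnizAlgebra

section EuclideanStokes

/-- The integral of a partial derivative of a compactly supported function vanishes. -/
theorem integral_fderiv_of_compact {d : ℕ} {u : E d → ℝ} {U C : Set (E d)} (hU : IsOpen U)
    (hC : IsCompact C) (hCU : C ⊆ U) (hu : ∀ y ∈ U, ContDiffAt ℝ 1 u y)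
    (h0 : ∀ y ∈ U, y ∉ C → u y = 0) (v : E d) :
    IntegrableOn (fun y => fderiv ℝ u y v) U ∧ ∫ y in U, fderiv ℝ u y v = 0 := by
  have hin : ∀ y ∈ U, U.indicator u =ᶠ[𝓝 y] u := fun y hy => by
    filter_upwards [hU.mem_nhds hy] with z hz
    exact indicator_of_mem hz u
  have hout : ∀ y ∉ C, U.indicator u =ᶠ[𝓝 y] 0 := fun y hy => by
    filter_upwards [hC.isClosed.isOpen_compl.mem_nhds hy] with z hz
    by_cases hzU : z ∈ U
    · rw [indicator_of_mem hzU, h0 z hzU hz, Pi.zero_apply]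
    · exact indicator_of_notMem hzU u
  have hcd : ContDiff ℝ 1 (U.indicator u) := contDiff_iff_contDiffAt.mpr fun y => by
    by_cases hy : y ∈ C
    · exact (hu y (hCU hy)).congr_of_eventuallyEq (hin y (hCU hy))
    · exact contDiffAt_const.congr_of_eventuallyEq (hout y hy)
  have hsupp : HasCompactSupport (U.indicator u) :=
    HasCompactSupport.intro hC fun y hy => (hout y hy).self_of_nhds
  have hi : Integrable (fun y => fderiv ℝ (U.indicator u) y v) :=
    ((hcd.continuous_fderiv (by simp)).clm_apply continuous_const).integrable_of_hasCompactSupport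
      (hsupp.fderiv_apply (𝕜 := ℝ) v)
  have heq : ∀ y ∈ U, fderiv ℝ (U.indicator u) y v = fderiv ℝ u y v := fun y hy => by
    rw [(hin y hy).fderiv_eq]
  refine ⟨hi.integrableOn.congr_fun heq hU.measurableSet, ?_⟩
  rw [← setIntegral_congr_fun hU.measurableSet heq, setIntegral_eq_integral_of_forall_compl_eq_zero]
  · -- integration by parts against the constant function `1`
    have := integral_mul_fderiv_eq_neg_fderiv_mul_of_integrable (μ := volume) (𝕜 := ℝ)
      (f := fun _ : E d => (1 : ℝ)) (g := U.indicator u) (v := v) (by simp) (by simpa using hi)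
      (by simpa using hcd.continuous.integrable_of_hasCompactSupport hsupp)
      (fun x _ => differentiableAt_const _) (fun x _ => (hcd.differentiable (by simp)) x)
    simpa using this
  · intro y hy
    rw [(hout y fun h => hy (hCU h)).fderiv_eq]
    simp

end EuclideanStokes

section Stokes

variable {d : ℕ} {M : Type*} [TopologicalSpace M] [ChartedSpace (E d) M]

theorem eventually_eq_zero {k : ℕ} {θ : DForm d M k} {x : M} (hx : x ∉ closure {z | θ z ≠ 0}) :
    ∀ᶠ z in 𝓝 x, θ z = 0 := by
  filter_upwards [isClosed_closure.isOpen_compl.mem_nhds hx] with z hz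
  by_contra h
  exact hz (subset_closure h)

theorem extD_eq_zero_of_eventually {k : ℕ} {θ : DForm d M k} {x : M}
    (hx : ∀ᶠ z in 𝓝 x, θ z = 0) : extD θ x = 0 := by
  rw [extD_congr (θ' := 0) hx, extD_zero]
  rfl

/-- The form `dη ∧ ν + (-1)^p η ∧ dν`, which is `d(η ∧ ν)`. -/
def leibnizForm {p l : ℕ} (h₁ : p + 1 + l = d) (h₂ : p + (l + 1) = d) (η : DForm d M p)
    (ν : DForm d M l) : DForm d M d :=
  wedgeForm h₁ (extD η) ν + mulForm (fun _ => (-1) ^ p) (wedgeForm h₂ η (extD ν))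

variable {p l : ℕ} (h₁ : p + 1 + l = d) (h₂ : p + (l + 1) = d)

theorem leibnizForm_apply (η : DForm d M p) (ν : DForm d M l) (x : M) :
    leibnizForm h₁ h₂ η ν x =
      wedge h₁ (extD η x) (ν x) + (-1 : ℝ) ^ p • wedge h₂ (η x) (extD ν x) := rfl

theorem leibnizForm_congr {η η' : DForm d M p} {ν : DForm d M l} {x : M}
    (h : ∀ᶠ z in 𝓝 x, η z = η' z) : leibnizForm h₁ h₂ η ν x = leibnizForm h₁ h₂ η' ν x := by
  rw [leibnizForm_apply, leibnizForm_apply, extD_congr h, h.self_of_nhds]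

theorem wedgeForm_apply_eq_zero {k k' n : ℕ} (h : k + k' = n) {α : DForm d M k} {β : DForm d M k'}
    {x : M} (hx : α x = 0 ∨ β x = 0) : wedgeForm h α β x = 0 := by
  rcases hx with hx | hx
  · rw [wedgeForm, hx, wedge_zero_left]
  · rw [wedgeForm, hx, wedge_zero_right]

theorem closure_wedgeForm_left {k l n : ℕ} (h : k + l = n) (α : DForm d M k) (β : DForm d M l) :
    closure {x | wedgeForm h α β x ≠ 0} ⊆ closure {x | α x ≠ 0} :=
  closure_mono fun _ hx h0 => hx (wedgeForm_apply_eq_zero h (Or.inl h0))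

theorem closure_wedgeForm_extD_left (η : DForm d M p) (ν : DForm d M l) :
    closure {x | wedgeForm h₁ (extD η) ν x ≠ 0} ⊆
      closure {x | η x ≠ 0} ∩ closure {x | ν x ≠ 0} := by
  refine closure_minimal (fun x hx => ⟨?_, ?_⟩) (isClosed_closure.inter isClosed_closure)
  · by_contra h
    exact hx (wedgeForm_apply_eq_zero h₁
      (Or.inl (extD_eq_zero_of_eventually (eventually_eq_zero h))))
  · by_contra h
    exact hx (wedgeForm_apply_eq_zero h₁ (Or.inr (eventually_eq_zero h).self_of_nhds))

theorem closure_wedgeForm_extD_right (η : DForm d M p) (ν : DForm d M l) :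
    closure {x | wedgeForm h₂ η (extD ν) x ≠ 0} ⊆
      closure {x | η x ≠ 0} ∩ closure {x | ν x ≠ 0} := by
  refine closure_minimal (fun x hx => ⟨?_, ?_⟩) (isClosed_closure.inter isClosed_closure)
  · by_contra h
    exact hx (wedgeForm_apply_eq_zero h₂ (Or.inl (eventually_eq_zero h).self_of_nhds))
  · by_contra h
    exact hx (wedgeForm_apply_eq_zero h₂
      (Or.inr (extD_eq_zero_of_eventually (eventually_eq_zero h))))

theorem closure_mulForm {k : ℕ} (f : M → ℝ) (θ : DForm d M k) :
    closure {x | mulForm f θ x ≠ 0} ⊆ tsupport f ∩ closure {x | θ x ≠ 0} := by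
  refine closure_minimal
    (fun x hx => ⟨subset_closure fun h => hx ?_, subset_closure fun h => hx ?_⟩)
    ((isClosed_tsupport f).inter isClosed_closure)
  · rw [mulForm, h, zero_smul]
  · rw [mulForm, h, smul_zero]

theorem leibnizForm_eq_zero {η : DForm d M p} {ν : DForm d M l} {x : M}
    (hx : x ∉ closure {x | η x ≠ 0} ∩ closure {x | ν x ≠ 0}) : leibnizForm h₁ h₂ η ν x = 0 := by
  have h1 : wedgeForm h₁ (extD η) ν x = 0 := by
    by_contra h
    exact hx (closure_wedgeForm_extD_left h₁ η ν (subset_closure h))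
  have h2 : wedgeForm h₂ η (extD ν) x = 0 := by
    by_contra h
    exact hx (closure_wedgeForm_extD_right h₂ η ν (subset_closure h))
  rw [wedgeForm] at h1 h2
  rw [leibnizForm_apply, h1, h2, smul_zero, add_zero]

theorem closure_leibnizForm (η : DForm d M p) (ν : DForm d M l) :
    closure {x | leibnizForm h₁ h₂ η ν x ≠ 0} ⊆
      closure {x | η x ≠ 0} ∩ closure {x | ν x ≠ 0} := by
  refine closure_minimal (fun x hx => ?_) (isClosed_closure.inter isClosed_closure)
  by_contra h
  exact hx (leibnizForm_eq_zero h₁ h₂ h)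

variable [IsManifold (𝓡 d) ∞ M]

theorem leibnizForm_add {η η' : DForm d M p} (hη : IsSmooth η) (hη' : IsSmooth η')
    (ν : DForm d M l) :
    leibnizForm h₁ h₂ (η + η') ν = leibnizForm h₁ h₂ η ν + leibnizForm h₁ h₂ η' ν := by
  funext x
  rw [Pi.add_apply, leibnizForm_apply, leibnizForm_apply, leibnizForm_apply, extD_add hη hη',
    Pi.add_apply, Pi.add_apply, wedge_add_left, wedge_add_left, smul_add]
  abel

theorem IsSmooth.leibnizForm {η : DForm d M p} {ν : DForm d M l} (hη : IsSmooth η)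
    (hν : IsSmooth ν) : IsSmooth (TwistedHodge.leibnizForm h₁ h₂ η ν) :=
  (hη.extD.wedgeForm h₁ hν).add ((hη.wedgeForm h₂ hν.extD).mulForm contMDiff_const)

variable (o : ManifoldOrientation d M)

/-- In a chart, the density of `dη ∧ ν + (-1)^p η ∧ dν` is a divergence. -/
theorem chartDensity_leibnizForm {η : DForm d M p} {ν : DForm d M l} (hη : IsSmooth η)
    (hν : IsSmooth ν) {m : M} {y : E d} (hy : y ∈ (extChartAt (𝓡 d) m).target) :
    chartDensity o m (leibnizForm h₁ h₂ η ν) y =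
      ∑ t, fderiv ℝ (fun z => chartSign o m z * (((p.factorial * l.factorial : ℕ) : ℝ)⁻¹ *
        ∑ i : Fin p → Fin d, ∑ j : Fin l → Fin d, permSign (cat h₁ (Fin.cons t i) j) *
          ((chartRep m η z fun a => stdBasis d (i a)) *
            chartRep m ν z fun a => stdBasis d (j a)))) y (stdBasis d t) := by
  have h : chartRep m (leibnizForm h₁ h₂ η ν) y (stdBasis d) =
      wedge h₁ (extDeriv (chartRep m η) y) (chartRep m ν y) (stdBasis d) +
        (-1) ^ p * wedge h₂ (chartRep m η y) (extDeriv (chartRep m ν) y) (stdBasis d) := by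
    rw [leibnizForm, chartRep_add, chartRep_mulForm, chartRep_wedgeForm, chartRep_wedgeForm,
      chartRep_extD hη hy, chartRep_extD hν hy]
    rfl
  rw [chartDensity, h, leibniz_stdBasis h₁ h₂ ((hη.contDiffAt hy).differentiableAt (by simp))
    ((hν.contDiffAt hy).differentiableAt (by simp)), Finset.mul_sum]
  refine Finset.sum_congr rfl fun t _ => ?_
  have : ∀ u : E d → ℝ, (fun z => chartSign o m z * u z) =ᶠ[𝓝 y]
      fun z => chartSign o m y * u z := fun u => by
    filter_upwards [chartSign_eventuallyEq o m hy] with z hz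
    rw [hz]
  have hc : ∀ u : E d → ℝ, fderiv ℝ (fun z => chartSign o m y * u z) y =
      chartSign o m y • fderiv ℝ u y := fun u =>
    congrFun (fderiv_const_smul_field (𝕜 := ℝ) (f := u) (chartSign o m y)) y
  rw [(this _).fderiv_eq, hc]
  rfl

variable [T2Space M] [SigmaCompactSpace M]

/-- The special case in which the supports of `η` and `ν` meet inside the domain of one chart: there
the integrand is a divergence of compactly supported functions. -/
theorem integralForm_leibnizForm_of_subset {η : DForm d M p} {ν : DForm d M l} (hη : IsSmooth η)
    (hν : IsSmooth ν) {m : M} (hK : IsCompact (closure {x | η x ≠ 0} ∩ closure {x | ν x ≠ 0}))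
    (hm : closure {x | η x ≠ 0} ∩ closure {x | ν x ≠ 0} ⊆ (extChartAt (𝓡 d) m).source) :
    integralForm o (leibnizForm h₁ h₂ η ν) = 0 := by
  have hsub := closure_leibnizForm h₁ h₂ η ν
  have ht := isOpen_extChartAt_target (I := 𝓡 d) m
  rw [integralForm_eq_setIntegral o (hη.leibnizForm h₁ h₂ hν)
    (hK.of_isClosed_subset isClosed_closure hsub) (hsub.trans hm),
    setIntegral_congr_fun ht.measurableSet fun y hy =>
      chartDensity_leibnizForm h₁ h₂ o hη hν hy]
  have key : ∀ t : Fin d, _ := fun t => integral_fderiv_of_compact (u := fun z => chartSign o m z *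
    (((p.factorial * l.factorial : ℕ) : ℝ)⁻¹ *
        ∑ i : Fin p → Fin d, ∑ j : Fin l → Fin d, permSign (cat h₁ (Fin.cons t i) j) *
          ((chartRep m η z fun a => stdBasis d (i a)) *
            chartRep m ν z fun a => stdBasis d (j a)))) ht
    (hK.image_of_continuousOn ((continuousOn_extChartAt m).mono hm))
    (image_subset_iff.mpr fun x hx => (extChartAt (𝓡 d) m).map_source (hm hx))
    (fun y hy => ?_) (fun y hy hn => ?_) (stdBasis d t)
  · rw [integral_finsetSum _ fun t _ => (key t).1]
    exact Finset.sum_eq_zero fun t _ => (key t).2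
  · refine ContDiffAt.of_le ?_ (n := ∞) (by simp)
    exact (contDiffAt_chartSign o m hy).mul (contDiffAt_const.mul (ContDiffAt.sum fun i _ =>
      ContDiffAt.sum fun j _ => contDiffAt_const.mul
        ((contDiffAt_alternating_apply (hη.contDiffAt hy) _).mul
          (contDiffAt_alternating_apply (hν.contDiffAt hy) _))))
  · have h0 : chartRep m η y = 0 ∨ chartRep m ν y = 0 := by
      rw [eq_zero_iff_chartRep η hy, eq_zero_iff_chartRep ν hy]
      by_contra! h
      exact hn ⟨_, ⟨subset_closure h.1, subset_closure h.2⟩, (extChartAt (𝓡 d) m).right_inv hy⟩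
    rcases h0 with h0 | h0 <;> simp [h0]

/-- Stokes' theorem for products: `∫ (dη ∧ ν + (-1)^p η ∧ dν) = 0` if the supports of `η` and `ν`
have compact intersection. -/
theorem integralForm_leibnizForm {η : DForm d M p} {ν : DForm d M l} (hη : IsSmooth η)
    (hν : IsSmooth ν) (hK : IsCompact (closure {x | η x ≠ 0} ∩ closure {x | ν x ≠ 0})) :
    integralForm o (leibnizForm h₁ h₂ η ν) = 0 := by
  have hfin := finite_tsupport_chartPartition_inter d hK
  have hsum : ∀ S : Finset M, ContMDiff (𝓡 d) 𝓘(ℝ, ℝ) ∞ fun x => ∑ i ∈ S, chartPartition d M i x :=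
    fun S => contMDiff_finsetSum fun i _ => (chartPartition d M i).contMDiff
  have hcpt : ∀ (f : M → ℝ), IsCompact (closure {x | mulForm f η x ≠ 0} ∩ closure {x | ν x ≠ 0}) :=
    fun f => hK.of_isClosed_subset (isClosed_closure.inter isClosed_closure)
      (inter_subset_inter_left _ ((closure_mulForm f η).trans inter_subset_right))
  -- each piece `ρᵢ η` is supported in the domain of one chart
  have hS : ∀ S : Finset M, integralForm o (leibnizForm h₁ h₂
      (mulForm (fun x => ∑ i ∈ S, chartPartition d M i x) η) ν) = 0 := by
    classical
    intro S
    induction S using Finset.induction_on with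
    | empty =>
      have : leibnizForm h₁ h₂
          (mulForm (fun x => ∑ i ∈ (∅ : Finset M), chartPartition d M i x) η) ν =
          mulForm (fun _ => 0) (leibnizForm h₁ h₂ η ν) := funext fun x => by
        rw [leibnizForm_eq_zero, mulForm, zero_smul]
        simp [mulForm]
      rw [this, integralForm_const_mul, zero_mul]
    | insert i S hi ih =>
      have h1 : mulForm (fun x => ∑ j ∈ insert i S, chartPartition d M j x) η =
          mulForm (chartPartition d M i) η + mulForm (fun x => ∑ j ∈ S, chartPartition d M j x) η :=
        funext fun x => by
          simp only [mulForm, Finset.sum_insert hi, add_smul, Pi.add_apply]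
      have hs1 := hη.mulForm (chartPartition d M i).contMDiff
      have hs2 := hη.mulForm (hsum S)
      rw [h1, leibnizForm_add h₁ h₂ hs1 hs2, integralForm_add o (hs1.leibnizForm h₁ h₂ hν)
        ((hcpt _).of_isClosed_subset isClosed_closure (closure_leibnizForm h₁ h₂ _ _))
        (hs2.leibnizForm h₁ h₂ hν)
        ((hcpt _).of_isClosed_subset isClosed_closure (closure_leibnizForm h₁ h₂ _ _)), ih,
        integralForm_leibnizForm_of_subset h₁ h₂ o hs1 hν (m := i) (hcpt _), add_zero]
      exact inter_subset_left.trans ((closure_mulForm _ η).trans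
        (inter_subset_left.trans (chartPartition_subset i)))
  -- near the common support, `η` is the sum of its finitely many pieces `ρᵢ η`
  rw [← hS hfin.toFinset]
  congr 1
  funext x
  by_cases hx : x ∈ closure {x | η x ≠ 0} ∩ closure {x | ν x ≠ 0}
  · refine leibnizForm_congr h₁ h₂ ?_
    filter_upwards [(chartPartition d M).eventually_fintsupport_subset x] with z hz
    have : ∑ i ∈ hfin.toFinset, chartPartition d M i z = 1 := by
      rw [← finsum_eq_sum_of_support_subset, (chartPartition d M).sum_eq_one (mem_univ _)]
      intro i hi
      rw [Finite.coe_toFinset]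
      have : i ∈ (chartPartition d M).fintsupport x :=
        hz (by rw [SmoothPartitionOfUnity.mem_fintsupport_iff]; exact subset_closure hi)
      rw [SmoothPartitionOfUnity.mem_fintsupport_iff] at this
      exact ⟨x, this, hx⟩
    rw [mulForm, this, one_smul]
  · rw [leibnizForm_eq_zero h₁ h₂ hx, leibnizForm_eq_zero h₁ h₂ fun h => hx ?_]
    exact ⟨((closure_mulForm _ η) h.1).2, h.2⟩

/-- Integration by parts: `∫ dη ∧ ν = (-1)^(p+1) ∫ η ∧ dν`. -/
theorem integralForm_extD_wedge {η : DForm d M p} {ν : DForm d M l} (hη : IsSmooth η)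
    (hν : IsSmooth ν) (hK : IsCompact (closure {x | η x ≠ 0} ∩ closure {x | ν x ≠ 0})) :
    integralForm o (wedgeForm h₁ (extD η) ν) =
      (-1) ^ (p + 1) * integralForm o (wedgeForm h₂ η (extD ν)) := by
  have h := integralForm_leibnizForm h₁ h₂ o hη hν hK
  have hc := hK.of_isClosed_subset isClosed_closure (closure_wedgeForm_extD_right h₂ η ν)
  rw [leibnizForm, integralForm_add o (hη.extD.wedgeForm h₁ hν)
    (hK.of_isClosed_subset isClosed_closure (closure_wedgeForm_extD_left h₁ η ν))
    ((hη.wedgeForm h₂ hν.extD).mulForm contMDiff_const)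
    (hc.of_isClosed_subset isClosed_closure ((closure_mulForm _ _).trans inter_subset_right)),
    integralForm_const_mul] at h
  rw [pow_succ]
  linarith

end Stokes

/-! ### Forms supported in a chart and nondegeneracy of the pairing -/

section LocalForms

variable {d : ℕ} {M : Type*} [TopologicalSpace M] [ChartedSpace (E d) M]

/-- The form which is `u • α` in the coordinates of the chart at `m`, and zero outside the domain
of the chart. -/
def localForm {k : ℕ} (m : M) (u : E d → ℝ) (α : E d [⋀^Fin k]→L[ℝ] ℝ) : DForm d M k :=
  open Classical in
  fun x => if x ∈ (extChartAt (𝓡 d) m).source then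
    u (extChartAt (𝓡 d) m x) •
      α.compContinuousLinearMap (chartSymmDeriv m (extChartAt (𝓡 d) m x)).inverse
  else (0 : E d [⋀^Fin k]→L[ℝ] ℝ)

theorem formAt_localForm {k : ℕ} {m : M} (u : E d → ℝ) (α : E d [⋀^Fin k]→L[ℝ] ℝ) {x : M}
    (hx : x ∈ (extChartAt (𝓡 d) m).source) :
    formAt (localForm m u α) x = u (extChartAt (𝓡 d) m x) •
      α.compContinuousLinearMap (chartSymmDeriv m (extChartAt (𝓡 d) m x)).inverse :=
  if_pos hx

theorem localForm_ne_zero_subset {k : ℕ} (m : M) (u : E d → ℝ) (α : E d [⋀^Fin k]→L[ℝ] ℝ) :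
    {x | localForm m u α x ≠ 0} ⊆ (extChartAt (𝓡 d) m).symm '' tsupport u := by
  intro x hx
  by_cases h : x ∈ (extChartAt (𝓡 d) m).source
  · refine ⟨extChartAt (𝓡 d) m x, subset_closure fun h0 => hx ?_,
      (extChartAt (𝓡 d) m).left_inv h⟩
    have := formAt_localForm u α h
    rw [h0, zero_smul] at this
    exact this
  · exact absurd (if_neg h) hx

theorem closure_localForm [T2Space M] {k : ℕ} {m : M} {u : E d → ℝ} (hc : HasCompactSupport u)
    (hm : tsupport u ⊆ (extChartAt (𝓡 d) m).target) (α : E d [⋀^Fin k]→L[ℝ] ℝ) :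
    closure {x | localForm m u α x ≠ 0} ⊆ (extChartAt (𝓡 d) m).symm '' tsupport u :=
  closure_minimal (localForm_ne_zero_subset m u α)
    (hc.isCompact.image_of_continuousOn ((continuousOn_extChartAt_symm m).mono hm)).isClosed

theorem isCompactlySupported_localForm [T2Space M] {k : ℕ} {m : M} {u : E d → ℝ}
    (hc : HasCompactSupport u) (hm : tsupport u ⊆ (extChartAt (𝓡 d) m).target)
    (α : E d [⋀^Fin k]→L[ℝ] ℝ) :
    IsCompactlySupported (localForm m u α) :=
  (hc.isCompact.image_of_continuousOn ((continuousOn_extChartAt_symm m).mono hm)).of_isClosed_subset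
    isClosed_closure (closure_localForm hc hm α)

variable [IsManifold (𝓡 d) ∞ M]

theorem chartRep_localForm {k : ℕ} {m : M} {u : E d → ℝ} {α : E d [⋀^Fin k]→L[ℝ] ℝ} {y : E d}
    (hy : y ∈ (extChartAt (𝓡 d) m).target) : chartRep m (localForm m u α) y = u y • α := by
  obtain ⟨e, he⟩ := chartSymmDeriv_inverse m hy
  have h1 : formAt (localForm m u α) ((extChartAt (𝓡 d) m).symm y) =
      u y • α.compContinuousLinearMap (e.symm : E d →L[ℝ] E d) := by
    rw [formAt_localForm u α ((extChartAt (𝓡 d) m).map_target hy),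
      (extChartAt (𝓡 d) m).right_inv hy, ← he, ContinuousLinearMap.inverse_equiv]
  rw [chartRep_eq, h1, ← he]
  ext v
  simp [Function.comp_def]

variable [T2Space M]

/-- A form supported in a compact part of a chart domain is smooth if its expression in that chart
is. -/
theorem isSmooth_of_chart {k : ℕ} {θ : DForm d M k} {m : M} {C : Set M} (hC : IsCompact C)
    (hCm : C ⊆ (extChartAt (𝓡 d) m).source) (h0 : {x | θ x ≠ 0} ⊆ C)
    (hθ : ∀ y ∈ (extChartAt (𝓡 d) m).target, ContDiffAt ℝ ∞ (chartRep m θ) y) :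
    IsSmooth θ := by
  refine isSmooth_of_forall fun x => ?_
  have hx := mem_extChartAt_target (I := 𝓡 d) x
  by_cases hxm : x ∈ (extChartAt (𝓡 d) m).source
  · have hov := overlap_self_mem hxm
    have h1 : chartRep x θ =ᶠ[𝓝 (extChartAt (𝓡 d) x x)] fun z =>
        (chartRep m θ (transition x m z)).compContinuousLinearMap
          (fderiv ℝ (transition x m) z) := by
      filter_upwards [(isOpen_overlap x m).mem_nhds hov] with z hz
      exact chartRep_transition θ hz
    refine ContDiffAt.congr_of_eventuallyEq ?_ h1
    exact contDiffAt_compContinuousLinearMap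
      ((hθ _ (transition_mem_overlap hov).1).comp _ (contDiffAt_transition hov))
      ((contDiffAt_transition hov).fderiv_right (by simp))
  · have h1 := chartRep_congr (θ' := 0) hx (by
      rw [extChartAt_to_inv]
      exact eventually_eq_zero fun h => hxm (hCm (closure_minimal h0 hC.isClosed h)))
    exact (contDiffAt_const (c := (0 : E d [⋀^Fin k]→L[ℝ] ℝ))).congr_of_eventuallyEq h1

theorem isSmooth_localForm {k : ℕ} {m : M} {u : E d → ℝ} (hu : ContDiff ℝ ∞ u)
    (hc : HasCompactSupport u) (hm : tsupport u ⊆ (extChartAt (𝓡 d) m).target)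
    (α : E d [⋀^Fin k]→L[ℝ] ℝ) : IsSmooth (localForm m u α) := by
  refine isSmooth_of_chart (m := m)
    (hc.isCompact.image_of_continuousOn ((continuousOn_extChartAt_symm m).mono hm)) ?_
    (localForm_ne_zero_subset m u α) fun y hy => ?_
  · exact image_subset_iff.mpr fun y hy => (extChartAt (𝓡 d) m).map_target (hm hy)
  · refine (hu.contDiffAt.smul (contDiffAt_const (c := α))).congr_of_eventuallyEq ?_
    filter_upwards [(isOpen_extChartAt_target m).mem_nhds hy] with z hz
    exact chartRep_localForm hz

end LocalForms

section Nondegeneracy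

variable {d : ℕ} {M : Type*} [TopologicalSpace M] [ChartedSpace (E d) M]
  [IsManifold (𝓡 d) ∞ M] [T2Space M] [SigmaCompactSpace M]

theorem integralForm_eq_zero (o : ManifoldOrientation d M) {θ : DForm d M d} (h : ∀ x, θ x = 0) :
    integralForm o θ = 0 := by
  have : θ = mulForm (fun _ => 0) θ := funext fun x => by rw [mulForm, zero_smul, h]
  rw [this, integralForm_const_mul, zero_mul]

/-- The fundamental lemma of the calculus of variations for forms: a smooth form whose wedge
products with all compactly supported smooth forms have vanishing integral is zero. -/
theorem eq_zero_of_integralForm_wedge (o : ManifoldOrientation d M) {k l : ℕ} (h : k + l = d)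
    {μ : DForm d M l} (hμ : IsSmooth μ)
    (hint : ∀ η : DForm d M k, IsSmooth η → IsCompactlySupported η →
      integralForm o (wedgeForm h η μ) = 0) : μ = 0 := by
  funext x
  have hx := mem_extChartAt_target (I := 𝓡 d) x
  have hU := isOpen_extChartAt_target (I := 𝓡 d) x
  refine eq_of_chartRep_eq (θ' := (0 : DForm d M l)) ?_
  change chartRep x μ (extChartAt (𝓡 d) x x) = 0
  refine eq_zero_of_wedge_eq_zero h (stdBasis d) _ fun α => ?_
  set f : E d → ℝ := fun y => chartSign o x y * wedge h α (chartRep x μ y) (stdBasis d) with hf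
  have hfc : ContinuousOn f (extChartAt (𝓡 d) x).target := fun y hy => by
    have h1 : ContDiffAt ℝ ∞ f y := by
      simp only [hf, wedge_basis]
      exact (contDiffAt_chartSign o x hy).mul (contDiffAt_const.mul (ContDiffAt.sum fun i _ =>
        ContDiffAt.sum fun j _ => contDiffAt_const.mul (contDiffAt_const.mul
          (contDiffAt_alternating_apply (hμ.contDiffAt hy) _))))
    exact h1.continuousAt.continuousWithinAt
  have hae := hU.ae_eq_zero_of_integral_contDiff_smul_eq_zero (μ := volume)
    (hfc.locallyIntegrableOn hU.measurableSet) fun u hu hc hsub => by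
      have h1 := hint (localForm x u α) (isSmooth_localForm hu hc hsub α)
        (isCompactlySupported_localForm hc hsub α)
      have hcl := (closure_wedgeForm_left h (localForm x u α) μ).trans (closure_localForm hc hsub α)
      rw [integralForm_eq_setIntegral o ((isSmooth_localForm hu hc hsub α).wedgeForm h hμ)
        ((isCompactlySupported_localForm hc hsub α).of_isClosed_subset isClosed_closure
          (closure_wedgeForm_left h _ μ)) (m := x)
        (hcl.trans (image_subset_iff.mpr fun y hy =>
          (extChartAt (𝓡 d) x).map_target (hsub hy)))] at h1
      rw [← h1, ← setIntegral_eq_integral_of_forall_compl_eq_zero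
        (s := (extChartAt (𝓡 d) x).target)]
      · refine setIntegral_congr_fun hU.measurableSet fun y hy => ?_
        simp only [hf, chartDensity, chartRep_wedgeForm, chartRep_localForm hy, wedge_smul_left,
          ContinuousAlternatingMap.smul_apply, smul_eq_mul]
        ring
      · intro y hy
        rw [image_eq_zero_of_notMem_tsupport fun hy' => hy (hsub hy'), zero_smul]
  have hzero := Measure.eqOn_open_of_ae_eq (μ := (volume : Measure (E d)))
    ((ae_restrict_iff' hU.measurableSet).mpr hae) hU hfc continuousOn_const hx
  have hs := chartSign_mul_self o x hx
  exact (mul_eq_zero.mp hzero).resolve_left (left_ne_zero_of_mul (by rw [hs]; norm_num))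

end Nondegeneracy

/-! ### The twisted operators -/

section TwistedOperators

variable {d : ℕ} {M : Type*} [TopologicalSpace M] [ChartedSpace (E d) M]
  [IsManifold (𝓡 d) ∞ M] (g : PseudoRiemannianMetric d M) (o : ManifoldOrientation d M)
  {lam : M → ℝ} (w : ℝ)

theorem IsSmooth.twistedCodiff (hlam : ContMDiff (𝓡 d) 𝓘(ℝ, ℝ) ∞ lam) {p : ℕ}
    {ξ : DForm d M (p + 1)} (hξ : IsSmooth ξ) :
    IsSmooth (TwistedHodge.twistedCodiff g o lam w ξ) :=
  ((hξ.mulForm (contMDiff_exp_mul w hlam)).codiff g o).mulForm (contMDiff_exp_neg_mul w hlam)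

/-- The twisted codifferential does not enlarge supports. -/
theorem closure_twistedCodiff {p : ℕ} (ξ : DForm d M (p + 1)) :
    closure {x | twistedCodiff g o lam w ξ x ≠ 0} ⊆ closure {x | ξ x ≠ 0} := by
  refine closure_minimal (fun x hx => ?_) isClosed_closure
  refine ((closure_mulForm (fun x => Real.exp (w * lam x)) ξ).trans inter_subset_right) ?_
  by_contra h
  exact hx (by rw [twistedCodiff, mulForm, codiff_eq_zero_of_eventually g o (eventually_eq_zero h),
    smul_zero])

theorem twistedCodiff_twistedCodiff (hlam : ContMDiff (𝓡 d) 𝓘(ℝ, ℝ) ∞ lam) {p : ℕ}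
    {ξ : DForm d M (p + 2)} (hξ : IsSmooth ξ) :
    twistedCodiff g o lam w (twistedCodiff g o lam w ξ) = 0 := by
  have h1 : ∀ μ : DForm d M (p + 1), mulForm (fun x => Real.exp (w * lam x))
      (mulForm (fun x => Real.exp (-(w * lam x))) μ) = μ := fun μ => by
    rw [mulForm_mulForm]
    funext x
    rw [mulForm, ← Real.exp_add, add_neg_cancel, Real.exp_zero, one_smul]
  rw [twistedCodiff, twistedCodiff, h1, codiff_codiff g o (hξ.mulForm (contMDiff_exp_mul w hlam))]
  exact funext fun x => smul_zero _

variable [T2Space M] [SigmaCompactSpace M]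

theorem weightedPairing_of_le {k : ℕ} (h : k ≤ d) (η ξ : DForm d M k) :
    weightedPairing g o lam w η ξ = integralForm o (mulForm (fun x => Real.exp (2 * w * lam x))
      (wedgeForm (k := k) (l := d - k) (n := d) (by omega) η
        (hodgeStar g o (k := k) (l := d - k) (by omega) ξ))) := by
  rw [weightedPairing, dif_pos h]
  rfl

/-- The weight `e^{2wλ}` of the pairing absorbs one factor `e^{-wλ}` and leaves a factor
`e^{wλ}` for the other form. -/
theorem weightedPairing_mulForm_left {k : ℕ} (h : k ≤ d) (η ξ : DForm d M k) :
    weightedPairing g o lam w (mulForm (fun x => Real.exp (-(w * lam x))) η) ξ =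
      integralForm o (wedgeForm (k := k) (l := d - k) (n := d) (by omega) η
        (hodgeStar g o (k := k) (l := d - k) (by omega)
          (mulForm (fun x => Real.exp (w * lam x)) ξ))) := by
  rw [weightedPairing_of_le g o w h, hodgeStar_mulForm]
  congr 1
  funext x
  simp only [mulForm, wedgeForm, wedge_smul_left, wedge_smul_right, smul_smul, ← Real.exp_add]
  congr 2
  ring

theorem weightedPairing_mulForm_right {k : ℕ} (h : k ≤ d) (η ξ : DForm d M k) :
    weightedPairing g o lam w η (mulForm (fun x => Real.exp (-(w * lam x))) ξ) =
      integralForm o (wedgeForm (k := k) (l := d - k) (n := d) (by omega)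
        (mulForm (fun x => Real.exp (w * lam x)) η)
        (hodgeStar g o (k := k) (l := d - k) (by omega) ξ)) := by
  rw [weightedPairing_of_le g o w h, hodgeStar_mulForm]
  congr 1
  funext x
  simp only [mulForm, wedgeForm, wedge_smul_left, wedge_smul_right, smul_smul, ← Real.exp_add]
  congr 2
  ring

/-- Adjointness of the twisted operators: integration by parts for `e^{wλ} η` and `* e^{wλ} ξ`. -/
theorem weightedPairing_twistedD (hlam : ContMDiff (𝓡 d) 𝓘(ℝ, ℝ) ∞ lam) {p : ℕ}
    {η : DForm d M p} {ξ : DForm d M (p + 1)} (hη : IsSmooth η) (hξ : IsSmooth ξ)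
    (hc : IsCompactlySupported η ∨ IsCompactlySupported ξ) :
    weightedPairing g o lam w (twistedD lam w η) ξ =
      weightedPairing g o lam w η (twistedCodiff g o lam w ξ) := by
  by_cases h : p + 1 ≤ d
  · have hη' := hη.mulForm (contMDiff_exp_mul w hlam)
    have hξ' := hξ.mulForm (contMDiff_exp_mul w hlam)
    have h1 : p + 1 + (d - (p + 1)) = d := by omega
    have h2 : p + (d - (p + 1) + 1) = d := by omega
    rw [twistedD, twistedCodiff, weightedPairing_mulForm_left g o w h,
      weightedPairing_mulForm_right g o w (by omega), wedge_hodgeStar_codiff g o h,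
      integralForm_const_mul]
    refine integralForm_extD_wedge h1 h2 o hη' (hξ'.hodgeStar g o h1) ?_
    have hs1 := (closure_mulForm (fun x => Real.exp (w * lam x)) η).trans inter_subset_right
    have hs2 : closure {x | hodgeStar g o h1 (mulForm (fun x => Real.exp (w * lam x)) ξ) x ≠ 0} ⊆
        closure {x | ξ x ≠ 0} :=
      (closure_mono fun x (hx : _ ≠ _) h0 => hx (hodgeStar_apply_eq_zero g o h1 h0)).trans
        ((closure_mulForm (fun x => Real.exp (w * lam x)) ξ).trans inter_subset_right)
    rcases hc with hc | hc
    · exact hc.of_isClosed_subset (isClosed_closure.inter isClosed_closure)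
        (inter_subset_left.trans hs1)
    · exact hc.of_isClosed_subset (isClosed_closure.inter isClosed_closure)
        (inter_subset_right.trans hs2)
  · -- for `p + 1 > d` both sides vanish
    rw [weightedPairing, dif_neg h, twistedCodiff, codiff_of_not_le g o h]
    by_cases hp : p ≤ d
    · rw [weightedPairing_mulForm_right g o w hp, integralForm_eq_zero]
      exact fun x => wedgeForm_apply_eq_zero _ (Or.inr (hodgeStar_apply_eq_zero g o _ rfl))
    · rw [weightedPairing, dif_neg hp]

/-- The weighted pairing separates smooth forms. -/
theorem eq_of_weightedPairing_eq (hlam : ContMDiff (𝓡 d) 𝓘(ℝ, ℝ) ∞ lam) {p : ℕ}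
    {ζ ζ' : DForm d M p} (hζ : IsSmooth ζ) (hζ' : IsSmooth ζ')
    (h : ∀ η : DForm d M p, IsSmooth η → IsCompactlySupported η →
      weightedPairing g o lam w η ζ = weightedPairing g o lam w η ζ') : ζ = ζ' := by
  by_cases hp : p ≤ d
  · have hpd : p + (d - p) = d := by omega
    have hexp := contMDiff_exp_mul (2 * w) hlam
    have hs := (hζ.hodgeStar g o hpd).mulForm hexp
    have hs' := (hζ'.hodgeStar g o hpd).mulForm hexp
    have hzero := eq_zero_of_integralForm_wedge o hpd
      (hs.add (hs'.mulForm (contMDiff_const (c := (-1 : ℝ))))) fun η hη hc => by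
        have hcpt : ∀ μ : DForm d M (d - p), IsCompactlySupported (wedgeForm hpd η μ) := fun μ =>
          hc.of_isClosed_subset isClosed_closure (closure_wedgeForm_left hpd η μ)
        have hη' := h η hη hc
        rw [weightedPairing_of_le g o w hp, weightedPairing_of_le g o w hp,
          ← wedgeForm_mulForm_right, ← wedgeForm_mulForm_right] at hη'
        rw [wedgeForm_add_right, integralForm_add o (hη.wedgeForm hpd hs) (hcpt _)
          (hη.wedgeForm hpd (hs'.mulForm contMDiff_const)) (hcpt _),
          wedgeForm_mulForm_right hpd (fun _ => -1), integralForm_const_mul, hη']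
        ring
    have hsub : ∀ (c : ℝ) (α β : E d [⋀^Fin (d - p)]→L[ℝ] ℝ), c ≠ 0 →
        c • α + (-1 : ℝ) • c • β = 0 → α = β := fun c α β hc h0 => by
      ext v
      have hv : c * α v + -1 * (c * β v) = 0 := congrArg (fun θ => θ v) h0
      exact mul_left_cancel₀ hc (by linarith)
    exact hodgeStar_injective g o hpd
      (funext fun x => hsub _ _ _ (Real.exp_ne_zero _) (congrFun hzero x))
  · rw [eq_zero_of_lt (not_le.mp hp) ζ, eq_zero_of_lt (not_le.mp hp) ζ']

end TwistedOperators

end TwistedHodge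

end

theorem mainTheorem6 {d : ℕ} {M : Type*} [TopologicalSpace M]
    [ChartedSpace (EuclideanSpace ℝ (Fin d)) M] [IsManifold (𝓡 d) ∞ M]
    [T2Space M] [SigmaCompactSpace M]
    (g : TwistedHodge.PseudoRiemannianMetric d M) (o : TwistedHodge.ManifoldOrientation d M)
    (lam : M → ℝ) (hlam : ContMDiff (𝓡 d) 𝓘(ℝ, ℝ) ∞ lam) (w : ℝ) :
    -- `e^{-wλ} δ e^{wλ}` is a formal adjoint of `e^{-wλ} d e^{wλ}` for the weighted pairing
    (∀ p : ℕ, TwistedHodge.IsFormalAdjoint (d := d) (M := M)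
      (TwistedHodge.weightedPairing g o lam w) (p := p)
      (TwistedHodge.twistedD lam w) (TwistedHodge.twistedCodiff g o lam w)) ∧
    -- it is the only one
    (∀ (p : ℕ) (ξ : TwistedHodge.DForm d M (p + 1)) (ζ : TwistedHodge.DForm d M p),
      TwistedHodge.IsSmooth ξ → TwistedHodge.IsSmooth ζ →
      (∀ η : TwistedHodge.DForm d M p,
        TwistedHodge.IsSmooth η → TwistedHodge.IsCompactlySupported η →
        TwistedHodge.weightedPairing g o lam w (TwistedHodge.twistedD lam w η) ξ =
          TwistedHodge.weightedPairing g o lam w η ζ) →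
      ζ = TwistedHodge.twistedCodiff g o lam w ξ) ∧
    -- it squares to zero
    (∀ (p : ℕ) (ξ : TwistedHodge.DForm d M (p + 2)), TwistedHodge.IsSmooth ξ →
      TwistedHodge.twistedCodiff g o lam w (TwistedHodge.twistedCodiff g o lam w ξ) = 0) := by
  have hT := fun (p : ℕ) (ξ : TwistedHodge.DForm d M (p + 1)) (hξ : TwistedHodge.IsSmooth ξ) =>
    TwistedHodge.IsSmooth.twistedCodiff g o w hlam hξ
  refine ⟨fun p => ⟨hT p, fun ξ _ hc => ?_, fun η ξ hη hξ hc => ?_⟩, fun p ξ ζ hξ hζ h => ?_,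
    fun p ξ hξ => TwistedHodge.twistedCodiff_twistedCodiff g o w hlam hξ⟩
  · exact hc.of_isClosed_subset isClosed_closure (TwistedHodge.closure_twistedCodiff g o w ξ)
  · exact TwistedHodge.weightedPairing_twistedD g o w hlam hη hξ hc
  · refine TwistedHodge.eq_of_weightedPairing_eq g o w hlam hζ (hT p ξ hξ) fun η hη hc => ?_
    rw [← h η hη hc]
    exact TwistedHodge.weightedPairing_twistedD g o w hlam hη hξ (Or.inl hc)
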